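/- Let $\mu\subseteq\lambda$ be strict partitions, let $S(\lambda/\mu)$ be the skew shifted shape (boxes in matrix notation, row $r$ of $S(\lambda)$ consisting of the boxes $(r,c)$ with $r\le c<r+\lambda_r$; the main diagonal consists of the boxes $(r,r)$), and let $n\ge 2$. For $k\in[n]$ write $\mathbf{k}$ for either of the letters $k',k$ of the alphabet $1'<1<2'<2<\cdots<n'<n$. A shifted semistandard tableau of shape $\lambda/\mu$ is a filling of $S(\lambda/\mu)$ with these letters whose rows and columns are weakly increasing, with at most one $k$ per column and at most one $k'$ per row, for each $k$. Its reading word is obtained by concatenating its rows from bottom to top. The canonical form of a filling is obtained by replacing, for each $k$, the leftmost $\mathbf{k}$ of the reading word, if there is one, by $k$. Let $\mathsf{ShST}(\lambda/\mu,n)$ be the set of shifted semistandard tableaux of shape $\lambda/\mu$ that equal their canonical form. The weight $\mathsf{wt}(T)\in\mathbb{Z}_{\ge0}^n$ has as $k$-th entry the number of boxes of $T$ containing $\mathbf{k}$. A permutation $\tau$ of $[n]$ acts on vectors by $\tau(v_1,\dots,v_n)=(v_{\tau^{-1}(1)},\dots,v_{\tau^{-1}(n)})$, and on fillings by replacing $k$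 by $\tau(k)$ and $k'$ by $\tau(k)'$ and then taking the canonical form. Let $\theta_i=(i,i+1)$ for $1\le i\le n-1$. For $a\ne b$ in $[n]$, the filling $\mathsf{SP}_{a,b}(T)$ is obtained from $T$ as follows. While some $\mathbf{a}$-box has a $\mathbf{b}$-box as its right or lower neighbour, select the rightmost such box containing $a$, or, if there is none containing $a$, the bottommost such box, which contains $a'$. Let $(r,c)$ be the selected box and apply one switch: * (two $\mathbf{b}$-neighbours) if $(r,c+1)$ contains $b'$, interchange $(r,c)$ and $(r,c+1)$ (S5); if $(r,c+1)$ contains $b$, interchange $(r,c)$ and $(r+1,c)$ (S6), except in the case (D) below (S7); * (only the right $\mathbf{b}$-neighbour) interchange $(r,c)$ and $(r,c+1)$ (S1), except that if $r=c$, $(r,r+1)$ contains $b'$ and $(r+1,r+1)$ contains $\mathbf{b}$, then interchange $(r,r)$ and $(r+1,r+1)$ and put $b$ in $(r,r+1)$ (S3); * (only the lower $\mathbf{b}$-neighbour) interchange $(r,c)$ and $(r+1,c)$ (S2), except in the case (D) below (S4); * (D) if $c=r+1$, $(r,r+1)$ contains $a$ and $(r,r)$ contains $\mathbf{a}$, then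 instead interchange $(r,r)$ and $(r+1,r+1)$ and put $a'$ in $(r,r+1)$. The shifted Bender–Knuth move is $\mathsf{t}_i(T):=\theta_i(\mathsf{SP}_{i,i+1}(T))$ for $T\in\mathsf{ShST}(\lambda/\mu,n)$ and $1\le i\le n-1$. **Proposition.** For all $1\le i\le n-1$, the move $\mathsf{t}_i$ maps $\mathsf{ShST}(\lambda/\mu,n)$ to itself, and on this set: 1. $\mathsf{t}_i^2=1$; 2. $\mathsf{t}_i\mathsf{t}_j=\mathsf{t}_j\mathsf{t}_i$ for all $1\le j\le n-1$ with $|i-j|>1$; 3. $\mathsf{wt}(\mathsf{t}_i(T))=\theta_i(\mathsf{wt}(T))$ for all $T\in\mathsf{ShST}(\lambda/\mu,n)$. Thus, for every $\nu\in\mathbb{Z}_{\ge0}^n$, $\mathsf{t}_i$ restricts to a bijection from $\{T\in\mathsf{ShST}(\lambda/\mu,n):\mathsf{wt}(T)=\nu\}$ to $\{T\in\mathsf{ShST}(\lambda/\mu,n):\mathsf{wt}(T)=\theta_i(\nu)\}$. -/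

import Mathlib

namespace ShiftedBK

/-- A letter of the primed alphabet `1' < 1 < 2' < 2 < ⋯ < n' < n`; the number `k + 1` of the
alphabet is represented by `k : Fin n`, and `primed` records whether the letter carries a prime. -/
@[ext]
structure Letter (n : ℕ) where
  val : Fin n
  primed : Bool

/-- The order `1' < 1 < 2' < 2 < ⋯ < n' < n`. -/
instance (n : ℕ) : LE (Letter n) :=
  ⟨fun x y => x.val < y.val ∨ (x.val = y.val ∧ (x.primed = true ∨ y.primed = false))⟩

/-- A strict partition `part 0 > part 1 > ⋯ > part (ℓ - 1) > 0`, continued by zeros. -/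
@[ext]
structure StrictPartition where
  part : ℕ → ℕ
  strict : ∀ r, 0 < part (r + 1) → part (r + 1) < part r
  finite : ∃ r, part r = 0

/-- The shifted shape of a strict partition. Boxes are pairs (row, column), both counted from `0`
in matrix notation; row `r` is shifted `r` units to the right, so the main diagonal is
`row = column`. -/
def shiftedShape (l : StrictPartition) : Set (ℕ × ℕ) :=
  {p | p.1 ≤ p.2 ∧ p.2 < p.1 + l.part p.1}

/-- Containment `μ ⊆ λ` of strict partitions, i.e. of their shifted shapes. -/
instance : LE StrictPartition := ⟨fun m l => shiftedShape m ⊆ shiftedShape l⟩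

/-- The skew shifted shape `S(l / m)`. -/
def skewShape (l m : StrictPartition) : Set (ℕ × ℕ) := shiftedShape l \ shiftedShape m

/-- A filling of boxes with primed letters; `none` marks the boxes that are not filled. -/
abbrev Filling (n : ℕ) := ℕ × ℕ → Option (Letter n)

/-- The box `p` contains the letter `k` or `k'`. -/
def HasLetter {n : ℕ} (T : Filling n) (k : Fin n) (p : ℕ × ℕ) : Prop :=
  ∃ x, T p = some x ∧ x.val = k

/-- `T` is a shifted semistandard tableau of shape `l / m` (not necessarily in canonical form). -/
structure IsSemistandard {n : ℕ} (l m : StrictPartition) (T : Filling n) : Prop where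
  shape : ∀ p, (T p).isSome = true ↔ p ∈ skewShape l m
  row_weak : ∀ r c d x y, c < d → T (r, c) = some x → T (r, d) = some y → x ≤ y
  col_weak : ∀ r s c x y, r < s → T (r, c) = some x → T (s, c) = some y → x ≤ y
  col_unprimed : ∀ r s c k, T (r, c) = some ⟨k, false⟩ → T (s, c) = some ⟨k, false⟩ → r = s
  row_primed : ∀ r c d k, T (r, c) = some ⟨k, true⟩ → T (r, d) = some ⟨k, true⟩ → c = d

/-- `p` comes before `q` in the reading word: rows are read from bottom to top, each row from left
to right. -/
def ReadsBefore (p q : ℕ × ℕ) : Prop := q.1 < p.1 ∨ (p.1 = q.1 ∧ p.2 < q.2)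

/-- `p` is the box of the leftmost `k` or `k'` of the reading word of `T`. -/
def IsFirst {n : ℕ} (T : Filling n) (k : Fin n) (p : ℕ × ℕ) : Prop :=
  HasLetter T k p ∧ ∀ q, HasLetter T k q → ¬ ReadsBefore q p

open scoped Classical in
/-- The canonical form of `T`: for each `k`, the leftmost `k` or `k'` of the reading word is
replaced by `k`. -/
noncomputable def canonicalize {n : ℕ} (T : Filling n) : Filling n := fun p =>
  (T p).map fun x => if IsFirst T x.val p then ⟨x.val, false⟩ else x

/-- The set `ShST(l / m, n)` of shifted semistandard tableaux of shape `l / m` on the alphabet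
`1' < 1 < ⋯ < n' < n`, in canonical form. -/
def ShST (l m : StrictPartition) (n : ℕ) : Set (Filling n) :=
  {T | IsSemistandard l m T ∧ canonicalize T = T}

/-- The weight: its `k`-th entry is the total number of `k` and `k'` in `T`. -/
noncomputable def weight {n : ℕ} (T : Filling n) : Fin n → ℕ :=
  fun k => {p | HasLetter T k p}.ncard

/-- The action of a permutation on vectors,
`τ (v₁, …, vₙ) = (v_{τ⁻¹(1)}, …, v_{τ⁻¹(n)})`. -/
def permVector {n : ℕ} (τ : Equiv.Perm (Fin n)) (v : Fin n → ℕ) : Fin n → ℕ :=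
  fun k => v (τ⁻¹ k)

/-- The action of a permutation on fillings: it acts on each letter, keeping primes, and the result
is put in canonical form. -/
noncomputable def permFilling {n : ℕ} (τ : Equiv.Perm (Fin n)) (T : Filling n) : Filling n :=
  canonicalize fun p => (T p).map fun x => ⟨τ x.val, x.primed⟩

/-- The simple transposition exchanging the `i`-th and the `(i+1)`-st of the letters
`1, …, n + 1`. -/
def theta {n : ℕ} (i : Fin n) : Equiv.Perm (Fin (n + 1)) := Equiv.swap i.castSucc i.succ

/-! ### Shifted switches

All operations below only look at, and only change, the boxes of `T` containing `a, a', b, b'`, that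
is, the pair `(T^a, T^b)` of border strips; the other boxes of `T` stay as they are. -/

/-- Interchange the contents of two boxes. -/
def swapBoxes {n : ℕ} (T : Filling n) (p q : ℕ × ℕ) : Filling n := fun x => T (Equiv.swap p q x)

open scoped Classical in
/-- The shifted switch (S1)–(S7) that applies to the box `p` of `T`, assumed to contain `a` or `a'`
and to be the north or west neighbour of a box with `b` or `b'`. -/
noncomputable def switchAt {n : ℕ} (a b : Fin n) (T : Filling n) (p : ℕ × ℕ) : Filling n :=
  let right : ℕ × ℕ := (p.1, p.2 + 1)
  let below : ℕ × ℕ := (p.1 + 1, p.2)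
  -- the west neighbour `(p.1, p.1)` of `p` and the box below `p` lie on the main diagonal,
  -- `p` contains an unprimed `a`, and the west neighbour contains `a` or `a'`
  let diagonalPair : Prop :=
    p.2 = p.1 + 1 ∧ T p = some ⟨a, false⟩ ∧ HasLetter T a (p.1, p.1)
  if HasLetter T b right ∧ HasLetter T b below then
    if T right = some ⟨b, true⟩ then
      -- (S5)
      swapBoxes T p right
    else if diagonalPair then
      -- (S7)
      Function.update (swapBoxes T (p.1, p.1) below) p (some ⟨a, true⟩)
    else
      -- (S6)
      swapBoxes T p below
  else if HasLetter T b right then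
    if p.1 = p.2 ∧ T right = some ⟨b, true⟩ ∧ HasLetter T b (p.1 + 1, p.2 + 1) then
      -- (S3)
      Function.update (swapBoxes T p (p.1 + 1, p.2 + 1)) right (some ⟨b, false⟩)
    else
      -- (S1)
      swapBoxes T p right
  else if HasLetter T b below then
    if diagonalPair then
      -- (S4)
      Function.update (swapBoxes T (p.1, p.1) below) p (some ⟨a, true⟩)
    else
      -- (S2)
      swapBoxes T p below
  else T

/-- `p` contains `a` or `a'` and is the west or north neighbour of a box with `b` or `b'`. -/
def Switchable {n : ℕ} (a b : Fin n) (T : Filling n) (p : ℕ × ℕ) : Prop :=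
  HasLetter T a p ∧ (HasLetter T b (p.1, p.2 + 1) ∨ HasLetter T b (p.1 + 1, p.2))

/-- No box with `a` or `a'` can be switched with a box with `b` or `b'`. -/
def FullySwitched {n : ℕ} (a b : Fin n) (T : Filling n) : Prop := ∀ p, ¬ Switchable a b T p

/-- The box at which the next switch takes place: the rightmost switchable box with an unprimed `a`
if there is one, otherwise the bottommost switchable box with `a'`. -/
def Selected {n : ℕ} (a b : Fin n) (T : Filling n) (p : ℕ × ℕ) : Prop :=
  Switchable a b T p ∧
    ((T p = some ⟨a, false⟩ ∧
        ∀ q, T q = some ⟨a, false⟩ → Switchable a b T q → q.2 ≤ p.2) ∨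
      ((∀ q, T q = some ⟨a, false⟩ → ¬ Switchable a b T q) ∧
        T p = some ⟨a, true⟩ ∧
        ∀ q, T q = some ⟨a, true⟩ → Switchable a b T q → q.1 ≤ p.1))

open scoped Classical in
/-- One step of the shifted switching process. -/
noncomputable def switchStep {n : ℕ} (a b : Fin n) (T : Filling n) : Filling n :=
  if h : ∃ p, Selected a b T p then switchAt a b T h.choose else T

open scoped Classical in
/-- The operator `SP_{a,b}`: the shifted switching process is applied to the pair `(T^a, T^b)`, with
the least number of steps after which the filling is fully switched. -/
noncomputable def SP {n : ℕ} (a b : Fin n) (T : Filling n) : Filling n :=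
  if h : ∃ m, FullySwitched a b ((switchStep a b)^[m] T) then
    (switchStep a b)^[Nat.find h] T
  else T

/-- The shifted Bender–Knuth move `t_i = θ_i ∘ SP_{i,i+1}` on fillings in an alphabet with `n + 1`
numbers. -/
noncomputable def benderKnuth {n : ℕ} (i : Fin n) (T : Filling (n + 1)) : Filling (n + 1) :=
  permFilling (theta i) (SP i.castSucc i.succ T)

end ShiftedBK

namespace ShiftedBK

/-! ### Growth diagrams -/

/-! List the boxes with `a`, `a'` as follows: the primed ones from top to bottom, then the unprimed
ones from left to right; likewise for `b = a + 1`. In canonical form the first unprimed box is the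
lowest and leftmost, so the successor of a primed box lies strictly below and weakly left of it, and
the successor of an unprimed box lies strictly right and weakly above (`Rel`, `VShape`). Hence the
primes are determined by the bare list of boxes (`VShape.eq_of_boxes_eq`). As far as `a` and `b` are
concerned, a canonical tableau amounts to two such lists whose concatenation is a linear extension
of a convex set (`exists_standardises`, `Fills.mem_shST`).

On bare lists, switching is a growth diagram built from the local rule `Sq`. The rule is
deterministic and self-inverse, so reflecting a diagram inverts it (`Grid.unique`, `Grid.symm`).

The core is `Inv.run`: `SP` follows this diagram and leaves lists of the shape `VShape`. The
`a`-boxes move outward one at a time, the last of the list first, each past all `b`-boxes. Away from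
the main diagonal the relative position of consecutive boxes is preserved (`Good.position`,
`VShape.step`), so primes travel with their boxes. At the diagonal a position can change its type,
and the special switches correct the primes: (S3) performs two squares of the diagram and removes a
prime from a `b`; (S4) and (S7) finish the row of one `a`-box, bring its predecessor from `(r, r)`
to `(r, r + 1)` and prime it. The invariant `Inv` compares consecutive `a`-boxes after they have
passed the same `b`-boxes.

Exchanging the two letters afterwards gives a canonical tableau again. Involutivity is the
reflection of diagrams, the weight is read off the lengths of the lists, and moves with `|i - j| >
1` concern disjoint pairs of letters. -/

/-- `q` is the right or lower neighbour of `p`. -/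
def Adj (p q : ℕ × ℕ) : Prop := q = (p.1, p.2 + 1) ∨ q = (p.1 + 1, p.2)

/-- The local rule: two consecutive boxes `x`, `y` of a growing chain of shapes, tagged differently,
exchange their tags; afterwards the box `y'` comes first and `x'` second. -/
inductive Sq : ℕ × ℕ → ℕ × ℕ → ℕ × ℕ → ℕ × ℕ → Prop
  | move {x y : ℕ × ℕ} : Adj x y → Sq x y x y
  | pass {x y : ℕ × ℕ} : ¬ Adj x y → ¬ Adj y x → Sq x y y x

/-- A box passes a list of boxes. -/
inductive Row : ℕ × ℕ → List (ℕ × ℕ) → List (ℕ × ℕ) → ℕ × ℕ → Prop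
  | nil (x) : Row x [] [] x
  | cons {x y y' x' ys ys' x''} : Sq x y y' x' → Row x' ys ys' x'' →
      Row x (y :: ys) (y' :: ys') x''

/-- A list of boxes is passed by a box. -/
inductive Col : List (ℕ × ℕ) → ℕ × ℕ → ℕ × ℕ → List (ℕ × ℕ) → Prop
  | nil (y) : Col [] y y []
  | cons {x xs y y' y'' x' xs'} : Col xs y y' xs' → Sq x y' y'' x' →
      Col (x :: xs) y y'' (x' :: xs')

/-- A list of boxes passes another list of boxes. -/
inductive Grid : List (ℕ × ℕ) → List (ℕ × ℕ) → List (ℕ × ℕ) → List (ℕ × ℕ) → Prop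
  | nil (ys) : Grid [] ys ys []
  | cons {x xs ys ys' ys'' x' xs'} : Grid xs ys ys' xs' → Row x ys' ys'' x' →
      Grid (x :: xs) ys ys'' (x' :: xs')

/-- Adjacent boxes keep their positions and only exchange tags, other pairs exchange their order;
the same rule undoes both. This is the source of `t_i ^ 2 = 1`. -/
theorem Sq.symm {x y y' x' : ℕ × ℕ} (h : Sq x y y' x') : Sq y' x' x y := by
  cases h with
  | move h => exact .move h
  | pass h h' => exact .pass h' h

theorem Sq.unique {x y y' x' y'' x'' : ℕ × ℕ} (h : Sq x y y' x') (h' : Sq x y y'' x'') :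
    y' = y'' ∧ x' = x'' := by
  cases h <;> cases h' <;> first | exact ⟨rfl, rfl⟩ | contradiction

theorem Row.unique {x : ℕ × ℕ} {ys ys' : List (ℕ × ℕ)} {x' : ℕ × ℕ} (h : Row x ys ys' x') :
    ∀ {ys'' x''}, Row x ys ys'' x'' → ys' = ys'' ∧ x' = x'' := by
  induction h with
  | nil => intro _ _ h; cases h; exact ⟨rfl, rfl⟩
  | cons hs _ ih =>
    intro _ _ h
    cases h with
    | cons hs' hr' =>
      obtain ⟨rfl, rfl⟩ := hs.unique hs'
      obtain ⟨rfl, rfl⟩ := ih hr'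
      exact ⟨rfl, rfl⟩

theorem Grid.unique {xs ys ys' xs' : List (ℕ × ℕ)} (h : Grid xs ys ys' xs') :
    ∀ {ys'' xs''}, Grid xs ys ys'' xs'' → ys' = ys'' ∧ xs' = xs'' := by
  induction h with
  | nil => intro _ _ h; cases h; exact ⟨rfl, rfl⟩
  | cons _ hr ih =>
    intro _ _ h
    cases h with
    | cons hg' hr' =>
      obtain ⟨rfl, rfl⟩ := ih hg'
      obtain ⟨rfl, rfl⟩ := hr.unique hr'
      exact ⟨rfl, rfl⟩

theorem Col.row {xs xs' : List (ℕ × ℕ)} {y y' : ℕ × ℕ} (h : Col xs y y' xs') :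
    Row y' xs' xs y := by
  induction h with
  | nil => exact .nil _
  | cons _ hs ih => exact .cons hs.symm ih

theorem Grid.nil_right (xs : List (ℕ × ℕ)) : Grid xs [] [] xs := by
  induction xs with
  | nil => exact .nil _
  | cons x xs ih => exact .cons ih (.nil _)

theorem Grid.eq_of_nil {xs ys' xs' : List (ℕ × ℕ)} (h : Grid xs [] ys' xs') :
    ys' = [] ∧ xs' = xs := by
  obtain ⟨h₁, h₂⟩ := h.unique (Grid.nil_right xs)
  exact ⟨h₁, h₂⟩

/-- A diagram is defined row by row; cutting off its first column prepares its reflection. -/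
theorem Grid.exists_col {xs : List (ℕ × ℕ)} : ∀ {y : ℕ × ℕ} {ys ys' xs' : List (ℕ × ℕ)},
    Grid xs (y :: ys) ys' xs' →
      ∃ y' ys'' xs'', ys' = y' :: ys'' ∧ Col xs y y' xs'' ∧ Grid xs'' ys ys'' xs' := by
  induction xs with
  | nil => intro y ys ys' xs' h; cases h; exact ⟨y, ys, [], rfl, .nil _, .nil _⟩
  | cons x xs ih =>
    intro y ys ys' xs' h
    cases h with
    | cons hg hr =>
      obtain ⟨y₁, ys₁, xs₁, rfl, hc, hg'⟩ := ih hg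
      cases hr with
      | cons hs hr' => exact ⟨_, _, _, rfl, .cons hc hs, .cons hg' hr'⟩

theorem Grid.symm {ys : List (ℕ × ℕ)} : ∀ {xs ys' xs' : List (ℕ × ℕ)},
    Grid xs ys ys' xs' → Grid ys' xs' xs ys := by
  induction ys with
  | nil =>
    intro xs ys' xs' h
    obtain ⟨rfl, rfl⟩ := h.eq_of_nil
    exact .nil _
  | cons y ys ih =>
    intro xs ys' xs' h
    obtain ⟨y', ys'', xs'', rfl, hc, hg⟩ := h.exists_col
    exact .cons (ih hg) hc.row

theorem Row.length_eq {x x' : ℕ × ℕ} {ys ys' : List (ℕ × ℕ)} (h : Row x ys ys' x') :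
    ys'.length = ys.length := by
  induction h with
  | nil => rfl
  | cons _ _ ih => simp [ih]

theorem Grid.length_eq {xs ys ys' xs' : List (ℕ × ℕ)} (h : Grid xs ys ys' xs') :
    ys'.length = ys.length ∧ xs'.length = xs.length := by
  induction h with
  | nil => exact ⟨rfl, rfl⟩
  | cons _ hr ih => exact ⟨hr.length_eq.trans ih.1, by simp [ih.2]⟩

theorem Row.append {x x' x'' : ℕ × ℕ} {ys ys' zs zs' : List (ℕ × ℕ)} (h : Row x ys ys' x') :
    Row x' zs zs' x'' → Row x (ys ++ zs) (ys' ++ zs') x'' := by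
  induction h with
  | nil => exact id
  | cons hs _ ih => exact fun h => .cons hs (ih h)

theorem Row.of_not_adj {x : ℕ × ℕ} {ys : List (ℕ × ℕ)}
    (h : ∀ y ∈ ys, ¬ Adj x y ∧ ¬ Adj y x) : Row x ys ys x := by
  induction ys with
  | nil => exact .nil _
  | cons y ys ih =>
    exact .cons (.pass (h y (by simp)).1 (h y (by simp)).2) (ih fun z hz => h z (by simp [hz]))

/-- `Grid` treats the first box last, whereas switching moves the last box first; this form attaches
the row that is run first. -/
theorem Grid.snoc {xs : List (ℕ × ℕ)} {x x' : ℕ × ℕ} {ys ys' : List (ℕ × ℕ)}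
    (hr : Row x ys ys' x') : ∀ {ys'' xs'}, Grid xs ys' ys'' xs' →
      Grid (xs ++ [x]) ys ys'' (xs' ++ [x']) := by
  induction xs with
  | nil => intro _ _ h; cases h; exact .cons (.nil _) hr
  | cons z xs ih =>
    intro _ _ h
    cases h with
    | cons hg hr' => exact .cons (ih hg) hr'

theorem Sq.le {x y y' x' : ℕ × ℕ} (h : Sq x y y' x') : x ≤ x' := by
  cases h with
  | move h => rcases h with rfl | rfl <;> constructor <;> simp
  | pass => exact le_rfl

theorem Row.le {x x' : ℕ × ℕ} {ys ys' : List (ℕ × ℕ)} (h : Row x ys ys' x') : x ≤ x' := by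
  induction h with
  | nil => exact le_rfl
  | cons hs _ ih => exact hs.le.trans ih

/-! ### Linear extensions of convex sets of boxes -/

/-- The list `L` enumerates a convex set of boxes, in an order compatible with the order of
boxes. -/
structure Good (L : List (ℕ × ℕ)) : Prop where
  lin : L.Pairwise fun p q => ¬ q ≤ p
  box : ∀ p ∈ L, p.1 ≤ p.2
  conv : ∀ p ∈ L, ∀ q ∈ L, ∀ s : ℕ × ℕ, s.1 ≤ s.2 → p ≤ s → s ≤ q → s ∈ L

theorem Good.nodup {L : List (ℕ × ℕ)} (h : Good L) : L.Nodup :=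
  h.lin.imp fun {p q} hpq (e : p = q) => hpq e.ge

/-- The boxes between two boxes of a segment belong to the segment. -/
theorem Good.seg {L₁ M L₂ : List (ℕ × ℕ)} (h : Good (L₁ ++ (M ++ L₂))) {p q s : ℕ × ℕ}
    (hp : p ∈ M) (hq : q ∈ M) (hs : s.1 ≤ s.2) (hps : p ≤ s) (hsq : s ≤ q) : s ∈ M := by
  have hmem := h.conv p (by simp [hp]) q (by simp [hq]) s hs hps hsq
  have hl := h.lin
  rw [List.pairwise_append, List.pairwise_append] at hl
  simp only [List.mem_append] at hmem hl
  rcases hmem with hmem | hmem | hmem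
  · exact absurd hps (hl.2.2 s hmem p (.inl hp))
  · exact hmem
  · exact absurd hsq (hl.2.1.2.2 q hq s hmem)

theorem Good.of_perm {L L' : List (ℕ × ℕ)} (h : Good L) (hp : L'.Perm L)
    (hl : L'.Pairwise fun p q => ¬ q ≤ p) : Good L' where
  lin := hl
  box p hpm := h.box p (hp.mem_iff.1 hpm)
  conv p hpm q hqm s hs h₁ h₂ :=
    hp.mem_iff.2 (h.conv p (hp.mem_iff.1 hpm) q (hp.mem_iff.1 hqm) s hs h₁ h₂)

/-- If `x ≤ y`, convexity puts a right or lower neighbour of `x` weakly between them, and the list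
leaves no room for a box other than `y`. -/
theorem Good.not_le_of_not_adj {L₁ L₂ : List (ℕ × ℕ)} {x y : ℕ × ℕ}
    (h : Good (L₁ ++ x :: y :: L₂)) (hn : ¬ Adj x y) : ¬ x ≤ y := by
  intro hle
  have hseg : ∀ s : ℕ × ℕ, s.1 ≤ s.2 → x ≤ s → s ≤ y → s = x ∨ s = y := fun s hs h₁ h₂ => by
    simpa using Good.seg (L₁ := L₁) (M := [x, y]) (L₂ := L₂) (by simpa using h)
      (p := x) (q := y) (by simp) (by simp) hs h₁ h₂
  have hlin : ¬ y ≤ x := by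
    have := h.lin
    rw [List.pairwise_append] at this
    exact (List.pairwise_cons.1 this.2.1).1 y (by simp)
  have hx := h.box x (by simp)
  have hy := h.box y (by simp)
  obtain ⟨r, c⟩ := x
  obtain ⟨s, d⟩ := y
  simp only [Adj, Prod.mk.injEq, Prod.mk_le_mk, not_or, not_and, Prod.forall] at *
  have h₁ := hseg r (c + 1)
  have h₂ := hseg (r + 1) c
  omega

theorem Good.exists_sq {L₁ L₂ : List (ℕ × ℕ)} {x y : ℕ × ℕ} (h : Good (L₁ ++ x :: y :: L₂)) :
    ∃ y' x', Sq x y y' x' := by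
  by_cases hxy : Adj x y
  · exact ⟨_, _, .move hxy⟩
  · refine ⟨_, _, .pass hxy fun hyx => ?_⟩
    have := h.lin
    rw [List.pairwise_append] at this
    refine (List.pairwise_cons.1 this.2.1).1 y (by simp) ?_
    rcases hyx with rfl | rfl <;> constructor <;> simp

/-- Consecutive boxes that pass each other are incomparable, so exchanging them keeps a linear
extension. -/
theorem Good.swap {L₁ L₂ : List (ℕ × ℕ)} {x y y' x' : ℕ × ℕ} (h : Good (L₁ ++ x :: y :: L₂))
    (hs : Sq x y y' x') : Good (L₁ ++ y' :: x' :: L₂) := by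
  cases hs with
  | move => exact h
  | pass hn _ =>
    refine h.of_perm (List.Perm.append_left _ (List.Perm.swap _ _ _)) ?_
    have hle := h.not_le_of_not_adj hn
    have hl := h.lin
    simp only [List.pairwise_append, List.pairwise_cons, List.mem_cons, forall_eq_or_imp] at hl ⊢
    refine ⟨hl.1, ⟨⟨hle, hl.2.1.2.1⟩, hl.2.1.1.2, hl.2.1.2.2⟩, fun z hz => ?_⟩
    have := hl.2.2 z hz
    exact ⟨this.2.1, this.1, this.2.2⟩

theorem Good.row {x x' : ℕ × ℕ} {ys ys' : List (ℕ × ℕ)} (hr : Row x ys ys' x') :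
    ∀ {L₁ L₂ : List (ℕ × ℕ)}, Good (L₁ ++ x :: (ys ++ L₂)) → Good (L₁ ++ (ys' ++ x' :: L₂)) := by
  induction hr with
  | nil => exact id
  | @cons x y y' x' ys ys' x'' hs _ ih =>
    intro L₁ L₂ h
    have := ih (L₁ := L₁ ++ [y']) (L₂ := L₂) (by simpa using h.swap hs)
    simpa using this

/-- `q` is strictly below and weakly left of `p`. -/
def Down (p q : ℕ × ℕ) : Prop := p.1 < q.1 ∧ q.2 ≤ p.2

/-- `q` is strictly right and weakly above of `p`. -/
def Rt (p q : ℕ × ℕ) : Prop := p.2 < q.2 ∧ q.1 ≤ p.1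

/-- Passing a box preserves the relative position of two consecutive boxes, except at the main
diagonal. -/
theorem Good.position {L₁ L₂ : List (ℕ × ℕ)} {x x₂ y₀ y x₂' y' x' : ℕ × ℕ}
    (h : Good (L₁ ++ x :: x₂ :: y₀ :: L₂)) (h₁ : Sq x₂ y₀ y x₂') (h₂ : Sq x y y' x') :
    (Down x x₂ → Down x' x₂') ∧
      (Rt x x₂ → Rt x' x₂' ∨
        ∃ r, x = (r, r) ∧ x₂ = (r, r + 1) ∧ y₀ = (r + 1, r + 1)) := by
  have hseg : ∀ s : ℕ × ℕ, s.1 ≤ s.2 → x ≤ s → s ≤ y₀ → s = x ∨ s = x₂ ∨ s = y₀ :=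
    fun s hs h₁ h₂ => by
      simpa using Good.seg (L₁ := L₁) (M := [x, x₂, y₀]) (L₂ := L₂) (by simpa using h)
        (p := x) (q := y₀) (by simp) (by simp) hs h₁ h₂
  have hseg' : ∀ s : ℕ × ℕ, s.1 ≤ s.2 → x₂ ≤ s → s ≤ y₀ → s = x₂ ∨ s = y₀ :=
    fun s hs h₁ h₂ => by
      simpa using Good.seg (L₁ := L₁ ++ [x]) (M := [x₂, y₀]) (L₂ := L₂) (by simpa using h)
        (p := x₂) (q := y₀) (by simp) (by simp) hs h₁ h₂
  have hl := h.lin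
  have hx := h.box x (by simp)
  have hx₂ := h.box x₂ (by simp)
  have hy := h.box y₀ (by simp)
  simp only [List.pairwise_append, List.pairwise_cons, List.mem_cons, forall_eq_or_imp] at hl
  have hl₁ := hl.2.1.1.1
  have hl₂ := hl.2.1.1.2.1
  have hl₃ := hl.2.1.2.1.1
  clear hl h
  obtain ⟨r, c⟩ := x
  obtain ⟨s, d⟩ := x₂
  obtain ⟨t, e⟩ := y₀
  -- Convexity is needed only for these eight boxes near `x` and `x₂`; what remains is linear
  -- arithmetic.
  have a₁ := hseg (r, c + 1)
  have a₂ := hseg (r + 1, c)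
  have a₃ := hseg' (s, d + 1)
  have a₄ := hseg' (s + 1, d)
  have a₅ := hseg (r, d)
  have a₆ := hseg (s, c)
  have a₇ := hseg (r, d + 1)
  have a₈ := hseg (r + 1, d)
  clear hseg hseg'
  cases h₁ <;> cases h₂ <;>
    simp only [Down, Rt, Adj, Prod.mk.injEq, Prod.mk_le_mk] at * <;>
    refine ⟨fun _ => ?_, fun _ => or_iff_not_imp_right.2 fun hne => ?_⟩ <;>
    first
      | omega
      | (by_contra; apply hne; refine ⟨r, ?_⟩; omega)

/-! ### Labelled lists of boxes -/

notation "boxes" => List.map (Prod.fst : (ℕ × ℕ) × Bool → ℕ × ℕ)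

/-- The relation between consecutive entries of the standardisation of the letters `k'`, `k`. -/
def Rel (z w : (ℕ × ℕ) × Bool) : Prop :=
  (z.2 = true ∧ Down z.1 w.1) ∨ (z.2 = false ∧ w.2 = false ∧ Rt z.1 w.1)

/-- First the primed boxes from top to bottom, then the unprimed boxes from left to right, the
first of which is the lowest and leftmost box. -/
def VShape : List ((ℕ × ℕ) × Bool) → Prop
  | [] => True
  | [z] => z.2 = false
  | z :: w :: L => Rel z w ∧ VShape (w :: L)

/-- The list `P` may be followed by `y`. -/
def Pre (P : List ((ℕ × ℕ) × Bool)) (y : (ℕ × ℕ) × Bool) : Prop := (P ++ [y]).IsChain Rel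

theorem pre_snoc {P : List ((ℕ × ℕ) × Bool)} {y z : (ℕ × ℕ) × Bool} :
    Pre (P ++ [y]) z ↔ Pre P y ∧ Rel y z := by
  simp only [Pre, List.append_assoc, List.cons_append, List.nil_append, List.isChain_append,
    List.isChain_cons_cons, List.isChain_singleton, List.head?_cons]
  tauto

theorem Pre.last {P : List ((ℕ × ℕ) × Bool)} {u y : (ℕ × ℕ) × Bool} (h : Pre P y)
    (hu : u ∈ P.getLast?) : Rel u y := by
  rw [Pre, List.isChain_append] at h
  exact h.2.2 u hu y (by simp)

theorem Pre.mono {P : List ((ℕ × ℕ) × Bool)} {y y' : (ℕ × ℕ) × Bool} (h : Pre P y)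
    (h' : ∀ u ∈ P.getLast?, Rel u y → Rel u y') : Pre P y' := by
  rw [Pre, List.isChain_append] at h ⊢
  refine ⟨h.1, List.isChain_singleton _, fun u hu w hw => ?_⟩
  obtain rfl : y' = w := by simpa using hw
  exact h' u hu (h.2.2 u hu y (by simp))

theorem vshape_append {P R : List ((ℕ × ℕ) × Bool)} {y : (ℕ × ℕ) × Bool} :
    VShape (P ++ y :: R) ↔ Pre P y ∧ VShape (y :: R) := by
  induction P with
  | nil => simp [Pre]
  | cons z P ih =>
    cases P with
    | nil => simp [Pre, VShape]
    | cons w P => simp_all [Pre, VShape, and_assoc]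

theorem VShape.isChain : ∀ {L : List ((ℕ × ℕ) × Bool)}, VShape L → L.IsChain Rel
  | [], _ => .nil
  | [_], _ => List.isChain_singleton _
  | _ :: _ :: _, h => List.isChain_cons_cons.2 ⟨h.1, VShape.isChain h.2⟩

/-- The relation between arbitrary entries of a standardisation. -/
def RelTrans (z w : (ℕ × ℕ) × Bool) : Prop :=
  (z.2 = true ∧ (w.2 = true → Down z.1 w.1)) ∨ (z.2 = false ∧ w.2 = false ∧ Rt z.1 w.1)

/-- `Rel` is not transitive: a primed box may have any position relative to a later unprimed one.
`RelTrans` forgets the position in that case. -/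
theorem pairwise_of_isChain {L : List ((ℕ × ℕ) × Bool)} (h : L.IsChain Rel) :
    L.Pairwise RelTrans := by
  have : IsTrans _ RelTrans := ⟨fun x y z hxy hyz => by
    unfold RelTrans Down Rt at *
    rcases hx : x.2 <;> rcases hy : y.2 <;> rcases hz : z.2 <;> simp_all <;> omega⟩
  refine List.IsChain.pairwise (h.imp fun z w hzw => ?_)
  rcases hzw with hzw | hzw
  · exact .inl ⟨hzw.1, fun _ => hzw.2⟩
  · exact .inr hzw

theorem Pre.relTrans {P : List ((ℕ × ℕ) × Bool)} {y z : (ℕ × ℕ) × Bool} (h : Pre P y)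
    (hz : z ∈ P) : RelTrans z y := by
  have := pairwise_of_isChain h
  rw [List.pairwise_append] at this
  exact this.2.2 z hz y (by simp)

/-- No box of the shifted plane is strictly below and weakly left of a diagonal box, so a diagonal
box cannot be primed. -/
theorem VShape.flag_of_diagonal {r : ℕ} {g : Bool} {R : List ((ℕ × ℕ) × Bool)}
    (h : VShape (((r, r), g) :: R)) (hb : ∀ z ∈ boxes R, z.1 ≤ z.2) : g = false := by
  cases R with
  | nil => exact h
  | cons z R =>
    rcases h.1 with h | h
    · have := hb z.1 (by simp)
      have := h.2
      simp only [Down] at this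
      omega
    · exact h.1

theorem Rel.flag_of_diagonal {r : ℕ} {g : Bool} {z : (ℕ × ℕ) × Bool} (h : Rel ((r, r), g) z)
    (hz : z.1.1 ≤ z.1.2) : g = false ∧ z.2 = false ∧ Rt (r, r) z.1 := by
  rcases h with h | h
  · have := h.2
    simp only [Down] at this
    omega
  · exact h

theorem Rel.flag_to_diagonal {r : ℕ} {g : Bool} {z : (ℕ × ℕ) × Bool} (h : Rel z ((r, r), g))
    (hz : z.1.1 ≤ z.1.2) : z.2 = true ∧ Down z.1 (r, r) := by
  rcases h with h | h
  · exact h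
  · have := h.2.2
    simp only [Rt] at this
    omega

theorem VShape.rt_or_rt {L : List ((ℕ × ℕ) × Bool)} (h : VShape L) {z w : (ℕ × ℕ) × Bool}
    (hz : z ∈ L) (hw : w ∈ L) (hz' : z.2 = false) (hw' : w.2 = false) (hne : z ≠ w) :
    Rt z.1 w.1 ∨ Rt w.1 z.1 := by
  have hp := (pairwise_of_isChain h.isChain).imp
    (S := fun z w => z.2 = false → w.2 = false → Rt z.1 w.1 ∨ Rt w.1 z.1)
    (fun {z w} hzw h₁ h₂ => by
      rcases hzw with hzw | hzw
      · simp_all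
      · exact .inl hzw.2.2)
  have : Std.Symm fun z w : (ℕ × ℕ) × Bool =>
      z.2 = false → w.2 = false → Rt z.1 w.1 ∨ Rt w.1 z.1 :=
    ⟨fun z w hzw h₁ h₂ => (hzw h₂ h₁).symm⟩
  exact hp.forall hz hw hne hz' hw'

/-- No two consecutive boxes of the main diagonal occur in the list. -/
def NoTwoDiagonal (L : List (ℕ × ℕ)) : Prop := ∀ r, (r, r) ∈ L → (r + 1, r + 1) ∉ L

/-- Diagonal boxes are unprimed, and of two unprimed boxes the one further right is weakly higher.
-/
theorem VShape.noTwoDiagonal {L : List ((ℕ × ℕ) × Bool)} (h : VShape L)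
    (hb : ∀ z ∈ boxes L, z.1 ≤ z.2) : NoTwoDiagonal (boxes L) := by
  have key : ∀ (r : ℕ) (g : Bool), ((r, r), g) ∈ L → g = false := by
    intro r g hm
    obtain ⟨A, B, rfl⟩ := List.append_of_mem hm
    exact (vshape_append.1 h).2.flag_of_diagonal fun z hz => hb z (by simp_all)
  intro r h₁ h₂
  simp only [List.mem_map, Prod.exists, exists_and_right, exists_eq_right] at h₁ h₂
  obtain ⟨g, h₁⟩ := h₁
  obtain ⟨g', h₂⟩ := h₂
  obtain rfl := key _ _ h₁
  obtain rfl := key _ _ h₂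
  have := h.rt_or_rt h₁ h₂ rfl rfl (by simp)
  simp only [Rt] at this
  omega

/-! ### Invariants of the switching process -/

/-- While the box `x` passes the boxes of the list, it comes to `(r, r + 1)` when `(r + 1, r + 1)` is
next. -/
inductive Hit (r : ℕ) : ℕ × ℕ → List (ℕ × ℕ) → Prop
  | here (ys) : Hit r (r, r + 1) ((r + 1, r + 1) :: ys)
  | there {x y y' x' ys} : Sq x y y' x' → Hit r x' ys → Hit r x (y :: ys)

theorem Hit.mem {r : ℕ} {x : ℕ × ℕ} {ys : List (ℕ × ℕ)} (h : Hit r x ys) :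
    (r + 1, r + 1) ∈ ys := by
  induction h with
  | here => simp
  | there _ _ ih => simp [ih]

theorem Hit.of_snoc {r : ℕ} {x x' y : ℕ × ℕ} {ys ys' : List (ℕ × ℕ)} (hr : Row x ys ys' x') :
    Hit r x (ys ++ [y]) → Hit r x ys ∨ (x' = (r, r + 1) ∧ y = (r + 1, r + 1)) := by
  induction hr with
  | nil =>
    intro h
    cases h with
    | here => exact .inr ⟨rfl, rfl⟩
    | there _ h => cases h
  | cons hs _ ih =>
    intro h
    cases h with
    | here => exact .inl (.here _)
    | there hs' h =>
      obtain ⟨-, rfl⟩ := hs.unique hs'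
      exact (ih h).imp_left (.there hs)

/-- The part of the invariant that concerns the boxes `xs` not yet moved and the present box `x`,
which started at `x₀`. -/
def PrefixInv (xs P : List ((ℕ × ℕ) × Bool)) (x : ℕ × ℕ) (f : Bool)
    (R D : List ((ℕ × ℕ) × Bool)) : Prop :=
  ∃ x₀ P₀, Row x₀ P₀ (boxes P) x ∧ Good (boxes xs ++ x₀ :: (P₀ ++ (boxes R ++ boxes D))) ∧
    Pre xs (x₀, f) ∧ NoTwoDiagonal (P₀ ++ boxes R) ∧
    ∀ u ∈ xs.getLast?, ∀ r, u.1 = (r, r) → ¬ Hit r x₀ P₀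

/-- The part of the invariant that concerns the present box `x` and the boxes `D` already moved. The
box `x₂` is the position of the first box of `D` when it had passed the same boxes as `x` has
now. -/
def SuffixInv (L : List (ℕ × ℕ)) (x : ℕ × ℕ) (f : Bool) (R : List (ℕ × ℕ)) :
    List ((ℕ × ℕ) × Bool) → Prop
  | [] => f = false
  | d :: D => VShape (d :: D) ∧ (f = false → d.2 = false) ∧
      ∃ x₂ R₀, Row x₂ R₀ R d.1 ∧ Good (L ++ x :: x₂ :: (R₀ ++ boxes D)) ∧
        NoTwoDiagonal R₀ ∧ (f = true → Down x x₂) ∧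
        (f = false → Rt x x₂ ∧ ∀ r, x = (r, r) → ¬ Hit r x₂ R₀)

theorem PrefixInv.good {xs P : List ((ℕ × ℕ) × Bool)} {x : ℕ × ℕ} {f : Bool}
    {R D : List ((ℕ × ℕ) × Bool)} (h : PrefixInv xs P x f R D) :
    Good (boxes xs ++ (boxes P ++ x :: (boxes R ++ boxes D))) := by
  obtain ⟨x₀, P₀, hr, hg, -⟩ := h
  exact Good.row hr hg

/-- The hypothesis `hn` keeps a `Hit` from arising; that configuration is left to (S4) and (S7). The
flag `g'` is free because only the boxes of `P` enter. -/
theorem PrefixInv.step {xs P : List ((ℕ × ℕ) × Bool)} {x y y' x' : ℕ × ℕ} {f g g' : Bool}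
    {R D : List ((ℕ × ℕ) × Bool)} (h : PrefixInv xs P x f ((y, g) :: R) D) (hs : Sq x y y' x')
    (hn : ∀ u ∈ xs.getLast?, ∀ r, u.1 = (r, r) → x = (r, r + 1) → y ≠ (r + 1, r + 1)) :
    PrefixInv xs (P ++ [(y', g')]) x' f R D := by
  obtain ⟨x₀, P₀, hr, hg, hp, hd, hh⟩ := h
  refine ⟨x₀, P₀ ++ [y], ?_, by simpa using hg, hp, by simpa using hd, fun u hu r hur hit => ?_⟩
  · simpa using hr.append (.cons hs (.nil _))
  · rcases hit.of_snoc hr with hit | ⟨h₁, h₂⟩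
    · exact hh u hu r hur hit
    · exact hn u hu r hur h₁ h₂

/-- `Good.position` compares `x` with its successor when both meet the same inward box. The diagonal
exception would be a `Hit` of the successor while `x` is on the diagonal, which the invariant
forbids. -/
theorem SuffixInv.step {L : List (ℕ × ℕ)} {x y y' x' : ℕ × ℕ} {f : Bool} {R : List (ℕ × ℕ)}
    {D : List ((ℕ × ℕ) × Bool)} (h : SuffixInv L x f (y :: R) D) (hs : Sq x y y' x') :
    SuffixInv (L ++ [y']) x' f R D := by
  cases D with
  | nil => exact h
  | cons d D =>
    obtain ⟨hv, hf, x₂, R₀, hr, hg, hd, hdown, hrt⟩ := h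
    cases hr with
    | @cons _ y₀ _ x₂' R₀ _ _ hs₂ hr =>
      have hg' : Good (L ++ y' :: x' :: x₂' :: (R₀ ++ boxes D)) := by
        have := Good.swap (L₁ := L ++ [x]) (L₂ := R₀ ++ boxes D) (by simpa using hg) hs₂
        exact Good.swap (L₁ := L) (by simpa using this) hs
      have hpos := Good.position (L₁ := L) (L₂ := R₀ ++ boxes D) (by simpa using hg) hs₂ hs
      refine ⟨hv, hf, x₂', R₀, hr, by simpa using hg', fun r h₁ h₂ => ?_, fun h => ?_, fun h => ?_⟩
      · exact hd r (by simp [h₁]) (by simp [h₂])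
      · exact hpos.1 (hdown h)
      · obtain ⟨hrt, hhit⟩ := hrt h
        refine ⟨?_, fun r hr' hit => ?_⟩
        · rcases hpos.2 hrt with h | ⟨r, rfl, rfl, rfl⟩
          · exact h
          · exact absurd (.here _) (hhit r rfl)
        · have hb := hg.box x (by simp)
          cases hs with
          | pass => exact hhit r hr' (.there hs₂ hit)
          -- `x` can reach `(r, r)` only from above. A later hit then needs an inward box at `(r +
          -- 1, r + 1)` besides the one met at `(r, r)`, against `NoTwoDiagonal`.
          | move hadj =>
            subst hr'
            cases hs₂ with
            | move =>
              simp only [Rt] at hrt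
              rcases hadj with hadj | hadj <;> simp only [Prod.mk.injEq] at hadj <;> omega
            | pass => exact hd r (by simp) (by simp [hit.mem])

theorem SuffixInv.row {x x' : ℕ × ℕ} {R R' : List (ℕ × ℕ)} (hr : Row x R R' x') :
    ∀ {L : List (ℕ × ℕ)} {f : Bool} {D : List ((ℕ × ℕ) × Bool)}, SuffixInv L x f R D →
      SuffixInv (L ++ R') x' f [] D := by
  induction hr with
  | nil => intro L f D h; simpa using h
  | cons hs _ ih => intro L f D h; simpa using ih (h.step hs)

theorem SuffixInv.vshape {L : List (ℕ × ℕ)} {x : ℕ × ℕ} {f : Bool}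
    {D : List ((ℕ × ℕ) × Bool)} (h : SuffixInv L x f [] D) : VShape ((x, f) :: D) := by
  cases D with
  | nil => exact h
  | cons d D =>
    obtain ⟨hv, hf, x₂, R₀, hr, hg, hd, hdown, hrt⟩ := h
    cases hr
    refine ⟨?_, hv⟩
    cases f with
    | true => exact .inl ⟨rfl, hdown rfl⟩
    | false => exact .inr ⟨rfl, hf rfl, (hrt rfl).1⟩

/-- An ordinary switch keeps the standardisation of the inner boxes. -/
theorem VShape.step {L P : List ((ℕ × ℕ) × Bool)} {x y y' x' : ℕ × ℕ} {g : Bool}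
    {R D : List ((ℕ × ℕ) × Bool)} (h : VShape (P ++ (y, g) :: R))
    (hg : Good (boxes L ++ (boxes P ++ x :: y :: (boxes R ++ boxes D)))) (hs : Sq x y y' x')
    (hn : ∀ r, x = (r, r) → y = (r, r + 1) → g = false) : VShape (P ++ (y', g) :: R) := by
  cases hs with
  | pass => exact h
  | move hadj =>
    rw [vshape_append] at h ⊢
    refine ⟨h.1.mono fun u hu hrel => ?_, ?_⟩
    · have hux : ¬ x ≤ u.1 := by
        have hm := List.mem_of_getLast? hu
        have := hg.lin
        rw [← List.append_assoc, List.pairwise_append] at this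
        exact this.2.2 u.1 (List.mem_append_right _ (List.mem_map_of_mem hm)) x (by simp)
      have := hg.box u.1 (List.mem_append_right _ (List.mem_append_left _
        (List.mem_map_of_mem (List.mem_of_getLast? hu))))
      obtain ⟨⟨s, d⟩, k⟩ := u
      obtain ⟨r, c⟩ := x
      unfold Rel Down Rt at *
      simp only [Prod.mk_le_mk] at *
      rcases hrel with ⟨hk, hrel⟩ | ⟨hk, hy, hrel⟩
      · refine .inl ⟨hk, ?_⟩
        rcases hadj with rfl | rfl <;> simp only at hrel ⊢ <;> omega
      · refine .inr ⟨hk, hy, ?_⟩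
        rcases hadj with rfl | rfl <;> simp only at hrel ⊢ <;> omega
    · cases R with
      | nil => exact h.2
      | cons z R =>
        refine ⟨?_, h.2.2⟩
        have hrel := h.2.1
        have hseg : ∀ s : ℕ × ℕ, s.1 ≤ s.2 → x ≤ s → s ≤ z.1 → s = x ∨ s = y ∨ s = z.1 :=
          fun s hs h₁ h₂ => by
            simpa using Good.seg (L₁ := boxes L ++ boxes P) (M := [x, y, z.1])
              (L₂ := boxes R ++ boxes D) (by simpa using hg) (p := x) (q := z.1) (by simp)
              (by simp) hs h₁ h₂
        have hx := hg.box x (by simp)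
        have hz := hg.box z.1 (by simp)
        obtain ⟨⟨s, d⟩, k⟩ := z
        obtain ⟨r, c⟩ := x
        -- When a primed `y` is the right neighbour of `x`, the test box `(r + 1, c)` forces `z`
        -- into a column weakly left of `x`. That box is missing from the plane only if `c = r`, the
        -- case excluded by `hn`.
        have a₁ := hseg (r, c + 1)
        have a₂ := hseg (r + 1, c)
        have a₃ := hseg (r + 1, c + 1)
        have a₄ := hn r
        unfold Rel Down Rt at *
        rcases hrel with ⟨hk, hrel⟩ | ⟨hk, hy, hrel⟩
        · refine .inl ⟨hk, ?_⟩
          have hk' : g = true := hk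
          simp only [hk'] at a₄
          rcases hadj with rfl | rfl <;>
            simp [Prod.mk_le_mk] at hrel hz a₁ a₂ a₃ a₄ ⊢ <;> omega
        · refine .inr ⟨hk, hy, ?_⟩
          rcases hadj with rfl | rfl <;>
            simp [Prod.mk_le_mk] at hrel hz a₁ a₂ a₃ ⊢ <;> omega

/-- The special switch at the main diagonal. -/
theorem VShape.diagonal_step {L P : List ((ℕ × ℕ) × Bool)} {r : ℕ}
    {R D : List ((ℕ × ℕ) × Bool)} (h : VShape (P ++ ((r, r + 1), true) :: R))
    (hg : Good (boxes L ++ (boxes P ++ (r, r) :: (r, r + 1) :: (boxes R ++ boxes D)))) :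
    ∃ R', R = ((r + 1, r + 1), false) :: R' ∧
      VShape (P ++ ((r, r), false) :: ((r, r + 1), false) :: R') := by
  rw [vshape_append] at h
  obtain ⟨hp, hv⟩ := h
  cases R with
  | nil => exact absurd hv (by simp [VShape])
  | cons z R =>
    obtain ⟨⟨s, d⟩, k⟩ := z
    obtain ⟨hrel, hv⟩ := hv
    have hb : s ≤ d := hg.box (s, d) (by simp)
    rcases hrel with hrel | hrel
    swap
    · exact absurd hrel.1 (by simp)
    have hd := hrel.2
    simp only [Down] at hd
    -- The only box of the plane strictly below and weakly left of `(r, r + 1)` is `(r + 1, r + 1)`.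
    obtain rfl : s = r + 1 := by omega
    obtain rfl : d = r + 1 := by omega
    obtain rfl := hv.flag_of_diagonal fun z hz => hg.box z (by simp_all)
    refine ⟨R, rfl, vshape_append.2 ⟨hp.mono fun u hu hrel => ?_, ?_⟩⟩
    · rcases hrel with hrel | hrel
      · refine .inl ⟨hrel.1, ?_⟩
        have := hrel.2
        simp only [Down] at this ⊢
        omega
      · exact absurd hrel.2.1 (by simp)
    · refine ⟨.inr ⟨rfl, rfl, by simp [Rt]⟩, ?_⟩
      cases R with
      | nil => rfl
      | cons w R =>
        refine ⟨?_, hv.2⟩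
        have hseg := fun h₁ h₂ => Good.seg (L₁ := boxes L ++ boxes P)
          (M := [(r, r), (r, r + 1), (r + 1, r + 1), w.1])
          (L₂ := boxes R ++ boxes D) (by simpa using hg) (p := (r, r)) (q := w.1)
          (s := (r, r + 2)) (by simp) (by simp) (by simp) h₁ h₂
        rcases hv.1 with h | h
        · exact absurd h.1 (by simp)
        · refine .inr ⟨rfl, h.2.1, ?_⟩
          have := h.2.2
          obtain ⟨⟨s, d⟩, k⟩ := w
          simp [Rt, Prod.mk_le_mk] at *
          omega

/-- The invariant of the switching process: `xs` lists the outward moving boxes not yet moved, `x` is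
the box moving at present, `D` lists the boxes already moved; `P` lists the inward moving boxes
already passed by `x`, and `R` those still to be passed. -/
structure Inv (xs P : List ((ℕ × ℕ) × Bool)) (x : ℕ × ℕ) (f : Bool)
    (R D : List ((ℕ × ℕ) × Bool)) : Prop where
  vshape : VShape (P ++ R)
  pre : PrefixInv xs P x f R D
  suf : SuffixInv (boxes xs ++ boxes P) x f (boxes R) D

theorem Inv.good {xs P : List ((ℕ × ℕ) × Bool)} {x : ℕ × ℕ} {f : Bool}
    {R D : List ((ℕ × ℕ) × Bool)} (h : Inv xs P x f R D) :
    Good (boxes xs ++ (boxes P ++ x :: (boxes R ++ boxes D))) := h.pre.good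

theorem Inv.step {xs P : List ((ℕ × ℕ) × Bool)} {x y y' x' : ℕ × ℕ} {f g : Bool}
    {R D : List ((ℕ × ℕ) × Bool)} (h : Inv xs P x f ((y, g) :: R) D) (hs : Sq x y y' x')
    (h₁ : ∀ u ∈ xs.getLast?, ∀ r, u.1 = (r, r) → x = (r, r + 1) → y ≠ (r + 1, r + 1))
    (h₂ : ∀ r, x = (r, r) → y = (r, r + 1) → g = false) :
    Inv xs (P ++ [(y', g)]) x' f R D where
  vshape := by simpa using h.vshape.step (by simpa using h.good) hs h₂
  pre := h.pre.step hs h₁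
  suf := by simpa using SuffixInv.step (L := boxes xs ++ boxes P) (by simpa using h.suf) hs

/-- (S3) performs two squares at once. The two inward boxes end side by side in row `r`, so the
first of them has to lose its prime. -/
theorem Inv.diagonal_step {xs P : List ((ℕ × ℕ) × Bool)} {r : ℕ} {f : Bool}
    {R D : List ((ℕ × ℕ) × Bool)} (h : Inv xs P (r, r) f (((r, r + 1), true) :: R) D) :
    ∃ R', R = ((r + 1, r + 1), false) :: R' ∧
      Inv xs (P ++ [((r, r), false), ((r, r + 1), false)]) (r + 1, r + 1) f R' D := by
  obtain ⟨R', rfl, hv⟩ := VShape.diagonal_step h.vshape (by simpa using h.good)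
  have s₁ : Sq (r, r) (r, r + 1) (r, r) (r, r + 1) := .move (.inl rfl)
  have s₂ : Sq (r, r + 1) (r + 1, r + 1) (r, r + 1) (r + 1, r + 1) := .move (.inr rfl)
  refine ⟨R', rfl, by simpa using hv, ?_, ?_⟩
  · have := (h.pre.step (g' := false) s₁ fun u _ s _ h => by simp at h; omega).step
      (g' := false) s₂ fun u hu s hus hs => by
        obtain rfl : r = s := by simpa using hs
        have hl := h.good.lin
        rw [List.pairwise_append] at hl
        exact absurd le_rfl (hus ▸ hl.2.2 u.1 (List.mem_map_of_mem (List.mem_of_getLast? hu)) (r, r)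
          (by simp))
    simpa using this
  · have := SuffixInv.step (SuffixInv.step (by simpa using h.suf) s₁) s₂
    simpa using this

/-- The box `x` has passed all of the list; the next box starts to move. -/
theorem Inv.next {xs P : List ((ℕ × ℕ) × Bool)} {z : (ℕ × ℕ) × Bool} {x : ℕ × ℕ} {f : Bool}
    {D : List ((ℕ × ℕ) × Bool)} (h : Inv (xs ++ [z]) P x f [] D) :
    Inv xs [] z.1 z.2 P ((x, f) :: D) := by
  have hg := h.good
  obtain ⟨hv, ⟨x₀, P₀, hr, hg₀, hp, hd, hh⟩, hs⟩ := h
  obtain ⟨hp, hrel⟩ := pre_snoc.1 hp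
  refine ⟨by simpa using hv, ?_, ?_⟩
  · refine ⟨z.1, [], .nil _, by simpa using hg, hp, ?_, fun u hu r hr hit => by simpa using hit.mem⟩
    simpa using VShape.noTwoDiagonal (L := P) (by simpa using hv) fun z hz => hg.box z (by simp_all)
  -- The start `x₀` of the finished box and the list `P₀` it met are kept in `PrefixInv` precisely
  -- to serve as the witnesses here: the next box has passed nothing yet.
  · refine ⟨hs.vshape, fun h => ?_, x₀, P₀, hr, by simpa using hg₀, by simpa using hd, fun h => ?_,
      fun h => ?_⟩
    · rcases hrel with hrel | hrel
      · simp_all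
      · exact hrel.2.1
    · rcases hrel with hrel | hrel
      · exact hrel.2
      · simp_all
    · rcases hrel with hrel | hrel
      · simp_all
      · exact ⟨hrel.2.2, hh z (by simp)⟩

/-- The box `x` is at `(r, r + 1)`, and `(r, r)`, `(r + 1, r + 1)` are its neighbours in the list. -/
theorem Inv.diagonal_flags {xs P : List ((ℕ × ℕ) × Bool)} {r : ℕ} {k f g : Bool}
    {R D : List ((ℕ × ℕ) × Bool)}
    (h : Inv (xs ++ [((r, r), k)]) P (r, r + 1) f (((r + 1, r + 1), g) :: R) D) :
    k = false ∧ f = false ∧ g = false := by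
  have hg := h.good
  obtain ⟨hv, ⟨x₀, P₀, hr, hg₀, hp, hd, hh⟩, hs⟩ := h
  obtain ⟨hp, hrel⟩ := pre_snoc.1 hp
  have := hrel.flag_of_diagonal (hg₀.box x₀ (by simp))
  exact ⟨this.1, this.2.1, (vshape_append.1 hv).2.flag_of_diagonal fun z hz => hg.box z (by simp_all)⟩

/-- A later inward box adjacent to `(r + 1, r + 1)` would be `(r + 1, r + 2)`. Convexity then adds
`(r, r + 2)`, giving two unprimed boxes in one column. -/
theorem Inv.row_of_diagonal {xs P : List ((ℕ × ℕ) × Bool)} {r : ℕ} {f : Bool}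
    {R D : List ((ℕ × ℕ) × Bool)}
    (h : Inv xs P (r, r + 1) f (((r + 1, r + 1), false) :: R) D) :
    Row (r + 1, r + 1) (boxes R) (boxes R) (r + 1, r + 1) := by
  have hg := h.good
  refine Row.of_not_adj fun z hz => ⟨?_, fun hadj => ?_⟩
  · have hbz := hg.box z (by simp_all)
    rintro (rfl | rfl)
    swap
    · simp at hbz
    obtain ⟨k, hk⟩ : ∃ k, ((r + 1, r + 2), k) ∈ R := by simpa using hz
    have hm : ((r, r + 2) : ℕ × ℕ) ∈ (r, r + 1) :: (r + 1, r + 1) :: boxes R :=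
      Good.seg (L₁ := boxes xs ++ boxes P) (L₂ := boxes D) (by simpa using hg) (p := (r, r + 1))
        (q := (r + 1, r + 2)) (by simp) (by exact List.mem_cons_of_mem _ (List.mem_cons_of_mem _ hz)) (by simp) (by simp [Prod.mk_le_mk])
        (by simp [Prod.mk_le_mk])
    obtain ⟨k', hk'⟩ : ∃ k, ((r, r + 2), k) ∈ R := by simpa using hm
    have hv := (vshape_append.1 h.vshape).2
    have hpw := (List.pairwise_cons.1 (pairwise_of_isChain hv.isChain)).1
    have h₁ := hpw _ hk
    have h₂ := hpw _ hk'
    simp only [RelTrans, Bool.false_eq_true, false_and, true_and, false_or] at h₁ h₂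
    have := hv.rt_or_rt (List.mem_cons_of_mem _ hk) (List.mem_cons_of_mem _ hk') h₁.1 h₂.1 (by simp)
    simp only [Rt] at this
    omega
  · have hl := hg.lin
    rw [List.pairwise_append, List.pairwise_append] at hl
    have := (List.pairwise_cons.1 (List.pairwise_cons.1 hl.2.1.2.1).2).1 z (by simp_all)
    rcases hadj with hadj | hadj <;> rw [hadj] at this <;> simp [Prod.le_def] at this

/-- The special switch at the main diagonal that involves two of the boxes moving outward. -/
theorem Inv.diagonal_pair_step {xs P : List ((ℕ × ℕ) × Bool)} {r : ℕ}
    {R D : List ((ℕ × ℕ) × Bool)}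
    (h : Inv (xs ++ [((r, r), false)]) P (r, r + 1) false (((r + 1, r + 1), false) :: R) D) :
    Row (r, r) (boxes P) (boxes P) (r, r) ∧
    Inv xs (P ++ [((r, r), false)]) (r, r + 1) true R (((r + 1, r + 1), false) :: D) := by
  have hg := h.good
  have hrow := h.row_of_diagonal
  have hl := hg.lin
  have hrowP : Row (r, r) (boxes P) (boxes P) (r, r) := by
    have hl' : (((boxes xs ++ [(r, r)]) ++ boxes P) ++ (r, r + 1) ::
      (r + 1, r + 1) :: (boxes R ++ boxes D)).Pairwise fun p q => ¬ q ≤ p := by simpa using hl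
    refine Row.of_not_adj fun z hz => ⟨?_, fun hadj => ?_⟩
    · have hbz := hg.box z (by simp_all)
      rintro (rfl | rfl)
      swap
      · simp at hbz
      exact (List.pairwise_append.1 hl').2.2 (r, r + 1) (by simp_all) (r, r + 1) (by simp) le_rfl
    · have := (List.pairwise_append.1 (List.pairwise_append.1 hl').1).2.2 (r, r) (by simp) z hz
      rcases hadj with hadj | hadj <;> simp [Prod.le_def, Prod.ext_iff] at this hadj <;> omega
  have hs₁ : Sq (r, r) (r, r + 1) (r, r) (r, r + 1) := .move (.inl rfl)
  have hs₂ : Sq (r, r + 1) (r + 1, r + 1) (r, r + 1) (r + 1, r + 1) := .move (.inr rfl)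
  obtain ⟨hv, ⟨x₀, P₀, hr, hg₀, hp, hd, hh⟩, hs⟩ := h
  obtain ⟨hp, hrel⟩ := pre_snoc.1 hp
  have hbxs : ∀ u ∈ xs.getLast?, u.1.1 ≤ u.1.2 := fun u hu =>
    hg.box _ (List.mem_append_left _ (by
      rw [List.map_append]
      exact List.mem_append_left _ (List.mem_map_of_mem (List.mem_of_getLast? hu))))
  obtain ⟨hvP, hvR⟩ := vshape_append.1 hv
  have hg₂ : Good (boxes xs ++ [(r, r)] ++ boxes P ++ (r, r + 1) ::
      (boxes R ++ (r + 1, r + 1) :: boxes D)) := by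
    have := Good.row hrow (L₁ := boxes xs ++ [(r, r)] ++ boxes P ++ [(r, r + 1)]) (L₂ := boxes D)
      (by simpa using hg)
    simpa using this
  refine ⟨hrowP, ?_, ?_, ?_⟩
  · rw [List.append_assoc, List.singleton_append, vshape_append]
    refine ⟨hvP.mono fun u hu hrel => ?_, ?_⟩
    · have hm := List.mem_map_of_mem (f := Prod.fst) (List.mem_of_getLast? hu)
      obtain ⟨h₁, h₂⟩ := hrel.flag_to_diagonal (hg.box _ (by simp [hm]))
      refine .inl ⟨h₁, ?_⟩
      have : ¬ (r, r + 1) ≤ u.1 := by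
        rw [← List.append_assoc, List.pairwise_append] at hl
        exact hl.2.2 u.1 (List.mem_append_right _ hm) _ (by simp)
      simp only [Down, Prod.le_def] at h₂ this ⊢
      omega
    · cases R with
      | nil => rfl
      | cons z R =>
        refine ⟨?_, hvR.2⟩
        obtain ⟨-, h₂, h₃⟩ := hvR.1.flag_of_diagonal (hg.box z.1 (by simp))
        refine .inr ⟨rfl, h₂, ?_⟩
        have hseg := fun h₁ h₂ => Good.seg (L₁ := boxes (xs ++ [((r, r), false)]) ++ boxes P)
          (M := [(r, r + 1), (r + 1, r + 1), z.1])
          (L₂ := boxes R ++ boxes D) (by simpa using hg) (p := (r, r + 1)) (q := z.1)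
          (s := (r, r + 2)) (by simp) (by simp) (by simp) h₁ h₂
        obtain ⟨⟨s, d⟩, k⟩ := z
        simp [Rt, Prod.mk_le_mk] at *
        omega
  -- The predecessor started at `(r, r)` and meets, after `boxes P`, the inward box that the
  -- previous mover has pulled to `(r, r + 1)`.
  · refine ⟨(r, r), boxes P ++ [(r, r + 1)], ?_, by simpa using hg₂, ?_, ?_, fun u hu ρ hur => ?_⟩
    · simpa using hrowP.append (.cons hs₁ (.nil _))
    -- The entry before a diagonal box is primed and above it, whatever the flag of the diagonal
    -- box; so that flag may become `true`.
    · exact hp.mono fun u hu hrel => .inl (hrel.flag_to_diagonal (hbxs u hu))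
    · have hnt := hv.noTwoDiagonal fun z hz => hg.box z (by simp_all; tauto)
      have hsub : ∀ ρ, (ρ, ρ) ∈ boxes P ++ [(r, r + 1)] ++ boxes R →
          (ρ, ρ) ∈ boxes (P ++ ((r + 1, r + 1), false) :: R) := by
        intro ρ hρ
        rw [List.map_append, List.map_cons]
        simp only [List.mem_append, List.mem_cons, List.not_mem_nil, Prod.mk.injEq, or_false]
          at hρ ⊢
        rcases hρ with (hρ | hρ) | hρ
        · exact .inl hρ
        · omega
        · exact .inr (.inr hρ)
      exact fun ρ h₁ h₂ => hnt ρ (hsub _ h₁) (hsub _ h₂)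
    -- `u` is strictly above and weakly right of `(r, r)`, hence off the diagonal, and the condition
    -- on `Hit` is empty.
    · have := ((hp.last hu).flag_to_diagonal (hbxs u hu)).2
      rw [hur] at this
      simp only [Down] at this
      omega
  · have hend := SuffixInv.row (.cons hs₂ hrow) hs
    refine ⟨hend.vshape, fun h => by simp at h, ?_⟩
    refine ⟨(r + 1, r + 1), boxes R, hrow, ?_, ?_,
      fun _ => by simp [Down], fun h => by simp at h⟩
    · have := Good.row hrowP (L₁ := boxes xs)
        (L₂ := (r, r + 1) :: (r + 1, r + 1) :: (boxes R ++ boxes D)) (by simpa using hg)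
      simpa using this
    · have hnt := hv.noTwoDiagonal fun z hz => hg.box z (by simp_all; tauto)
      exact fun ρ h₁ h₂ => hnt ρ (by simp [h₁]) (by simp [h₂])

/-! ### Simulation of the switching process -/

/-- The filling `T` has the letters `a`, `a'` in the boxes of the list `A`, the letters `b`, `b'` in
the boxes of the list `B`, and agrees with `T₀` elsewhere. -/
structure Fills {n : ℕ} (a b : Fin n) (T₀ T : Filling n) (A B : List ((ℕ × ℕ) × Bool)) : Prop where
  left : ∀ z ∈ A, T z.1 = some ⟨a, z.2⟩
  right : ∀ z ∈ B, T z.1 = some ⟨b, z.2⟩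
  off : ∀ p, p ∉ boxes A → p ∉ boxes B →
    T p = T₀ p ∧ ∀ g, T₀ p ≠ some ⟨a, g⟩ ∧ T₀ p ≠ some ⟨b, g⟩

/-! ### Fillings described by two labelled lists, and the effect of single switches on them. -/

section
variable {n : ℕ} {a b : Fin n} {T₀ T : Filling n} {A B : List ((ℕ × ℕ) × Bool)}

theorem mem_boxes {L : List ((ℕ × ℕ) × Bool)} {p : ℕ × ℕ} : p ∈ boxes L ↔ ∃ g, (p, g) ∈ L := by
  simp only [List.mem_map, Prod.exists, exists_and_right, exists_eq_right]

theorem Fills.eq_left (h : Fills a b T₀ T A B) (hab : a ≠ b) {p : ℕ × ℕ} {g : Bool} :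
    T p = some ⟨a, g⟩ ↔ (p, g) ∈ A := by
  refine ⟨fun hp => ?_, fun hp => h.left _ hp⟩
  by_cases hA : p ∈ boxes A
  · obtain ⟨k, hk⟩ := mem_boxes.1 hA
    have := h.left _ hk
    simp_all
  · by_cases hB : p ∈ boxes B
    · obtain ⟨k, hk⟩ := mem_boxes.1 hB
      have := h.right _ hk
      simp_all
    · have := h.off p hA hB
      rw [hp] at this
      exact absurd this.1.symm (this.2 g).1

theorem Fills.symm (h : Fills a b T₀ T A B) : Fills b a T₀ T B A :=
  ⟨h.right, h.left, fun p hB hA =>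
    ⟨(h.off p hA hB).1, fun g => ⟨((h.off p hA hB).2 g).2, ((h.off p hA hB).2 g).1⟩⟩⟩

theorem Fills.eq_right (h : Fills a b T₀ T A B) (hab : a ≠ b) {p : ℕ × ℕ} {g : Bool} :
    T p = some ⟨b, g⟩ ↔ (p, g) ∈ B := h.symm.eq_left hab.symm

theorem hasLetter_iff {k : Fin n} {p : ℕ × ℕ} : HasLetter T k p ↔ ∃ g, T p = some ⟨k, g⟩ := by
  constructor
  · rintro ⟨⟨k, g⟩, h, rfl⟩
    exact ⟨g, h⟩
  · rintro ⟨g, h⟩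
    exact ⟨_, h, rfl⟩

theorem Fills.hasLetter_left (h : Fills a b T₀ T A B) (hab : a ≠ b) {p : ℕ × ℕ} :
    HasLetter T a p ↔ p ∈ boxes A := by
  simp only [hasLetter_iff, h.eq_left hab, mem_boxes]

theorem Fills.hasLetter_right (h : Fills a b T₀ T A B) (hab : a ≠ b) {p : ℕ × ℕ} :
    HasLetter T b p ↔ p ∈ boxes B := h.symm.hasLetter_left hab.symm

theorem Fills.change {T' : Filling n} {A' B' : List ((ℕ × ℕ) × Bool)} (h : Fills a b T₀ T A B)
    (hp : (boxes A' ++ boxes B').Perm (boxes A ++ boxes B))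
    (hA : ∀ z ∈ A', T' z.1 = some ⟨a, z.2⟩) (hB : ∀ z ∈ B', T' z.1 = some ⟨b, z.2⟩)
    (hoff : ∀ p, p ∉ boxes A → p ∉ boxes B → T' p = T p) : Fills a b T₀ T' A' B' := by
  refine ⟨hA, hB, fun p h₁ h₂ => ?_⟩
  have hm := not_congr (hp.mem_iff (a := p))
  simp only [List.mem_append, not_or] at hm
  obtain ⟨h₁, h₂⟩ := hm.1 ⟨h₁, h₂⟩
  rw [hoff p h₁ h₂]
  exact h.off p h₁ h₂

theorem swapBoxes_of_ne {p q s : ℕ × ℕ} (h₁ : s ≠ p) (h₂ : s ≠ q) : swapBoxes T p q s = T s := by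
  rw [swapBoxes, Equiv.swap_apply_of_ne_of_ne h₁ h₂]

theorem swapBoxes_left {p q : ℕ × ℕ} : swapBoxes T p q p = T q := by
  rw [swapBoxes, Equiv.swap_apply_left]

theorem swapBoxes_right {p q : ℕ × ℕ} : swapBoxes T p q q = T p := by
  rw [swapBoxes, Equiv.swap_apply_right]

theorem Fills.swap {xs P R D : List ((ℕ × ℕ) × Bool)} {x y : ℕ × ℕ} {f g : Bool}
    (h : Fills a b T₀ T (xs ++ (x, f) :: D) (P ++ (y, g) :: R))
    (hn : (boxes xs ++ (boxes P ++ x :: (y :: boxes R ++ boxes D))).Nodup) :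
    Fills a b T₀ (swapBoxes T x y) (xs ++ (y, f) :: D) (P ++ [(x, g)] ++ R) := by
  have hx : ∀ z ∈ xs ++ D ++ P ++ R, z.1 ≠ x ∧ z.1 ≠ y := by
    intro z hz
    have hz' : z.1 ∈ boxes xs ++ boxes D ++ boxes P ++ boxes R := by
      simpa only [List.map_append] using List.mem_map_of_mem (f := Prod.fst) hz
    have hn' : (x :: y :: (boxes xs ++ boxes D ++ boxes P ++ boxes R)).Nodup := by
      refine (List.Perm.nodup_iff ?_).1 hn
      simp only [← Multiset.coe_eq_coe, ← Multiset.coe_add, ← Multiset.cons_coe,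
        Multiset.cons_add, Multiset.add_cons]
      congr 2
      abel
    simp only [List.nodup_cons] at hn'
    constructor <;> rintro rfl
    · exact hn'.1 (List.mem_cons_of_mem _ hz')
    · exact hn'.2.1 hz'
  refine h.change ?_ (fun z hz => ?_) (fun z hz => ?_) (fun p h₁ h₂ => ?_)
  · simp only [List.map_append, List.map_cons, List.map_nil, ← Multiset.coe_eq_coe,
      ← Multiset.coe_add, ← Multiset.cons_coe, Multiset.cons_add, Multiset.add_cons,
      Multiset.coe_nil, add_zero]
    rw [Multiset.cons_swap]
  · simp only [List.mem_append, List.mem_cons] at hz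
    by_cases hz' : z = (y, f)
    · rw [hz', swapBoxes_right]
      exact h.left (x, f) (by simp)
    · have := hx z (by simp only [List.mem_append]; tauto)
      rw [swapBoxes_of_ne this.1 this.2]
      exact h.left z (by simp only [List.mem_append, List.mem_cons]; tauto)
  · simp only [List.mem_append, List.mem_cons, List.not_mem_nil, or_false] at hz
    by_cases hz' : z = (x, g)
    · rw [hz', swapBoxes_left]
      exact h.right (y, g) (by simp)
    · have := hx z (by simp only [List.mem_append]; tauto)
      rw [swapBoxes_of_ne this.1 this.2]
      exact h.right z (by simp only [List.mem_append, List.mem_cons]; tauto)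
  · refine swapBoxes_of_ne ?_ ?_ <;> rintro rfl <;> simp at h₁ h₂

theorem Fills.diagonal_swap {xs P R D : List ((ℕ × ℕ) × Bool)} {x y z : ℕ × ℕ} {f : Bool}
    (h : Fills a b T₀ T (xs ++ (x, f) :: D) (P ++ (y, true) :: (z, false) :: R))
    (hn : (boxes xs ++ (boxes P ++ x :: (y :: z :: boxes R ++ boxes D))).Nodup) :
    Fills a b T₀ (Function.update (swapBoxes T x z) y (some ⟨b, false⟩)) (xs ++ (z, f) :: D)
      (P ++ [(x, false), (y, false)] ++ R) := by
  have hn' : (x :: y :: z :: (boxes xs ++ boxes D ++ boxes P ++ boxes R)).Nodup := by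
    refine (List.Perm.nodup_iff ?_).1 hn
    simp only [← Multiset.coe_eq_coe, ← Multiset.coe_add, ← Multiset.cons_coe,
      Multiset.cons_add, Multiset.add_cons]
    congr 3
    abel
  simp only [List.nodup_cons, List.mem_cons, not_or] at hn'
  have hx : ∀ w ∈ xs ++ D ++ P ++ R, w.1 ≠ x ∧ w.1 ≠ y ∧ w.1 ≠ z := by
    intro w hw
    have hw' : w.1 ∈ boxes xs ++ boxes D ++ boxes P ++ boxes R := by
      simpa only [List.map_append] using List.mem_map_of_mem (f := Prod.fst) hw
    refine ⟨?_, ?_, ?_⟩ <;> rintro rfl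
    · exact hn'.1.2.2 hw'
    · exact hn'.2.1.2 hw'
    · exact hn'.2.2.1 hw'
  have hu : ∀ w ∈ xs ++ D ++ P ++ R,
      Function.update (swapBoxes T x z) y (some ⟨b, false⟩) w.1 = T w.1 := fun w hw => by
    have := hx w hw
    rw [Function.update_of_ne this.2.1, swapBoxes_of_ne this.1 this.2.2]
  refine h.change ?_ (fun w hw => ?_) (fun w hw => ?_) (fun p h₁ h₂ => ?_)
  · simp only [List.map_append, List.map_cons, List.map_nil, ← Multiset.coe_eq_coe,
      ← Multiset.coe_add, ← Multiset.cons_coe, Multiset.cons_add, Multiset.add_cons,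
      Multiset.coe_nil, add_zero]
    rw [Multiset.cons_swap z x]
    exact Multiset.cons_swap _ _ _
  · simp only [List.mem_append, List.mem_cons] at hw
    by_cases hw' : w = (z, f)
    · rw [hw', Function.update_of_ne (Ne.symm hn'.2.1.1), swapBoxes_right]
      exact h.left (x, f) (by simp)
    · rw [hu w (by simp only [List.mem_append]; tauto)]
      exact h.left w (by simp only [List.mem_append, List.mem_cons]; tauto)
  · simp only [List.mem_append, List.mem_cons, List.not_mem_nil, or_false] at hw
    by_cases hw' : w = (x, false)
    · rw [hw', Function.update_of_ne hn'.1.1, swapBoxes_left]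
      exact h.right (z, false) (by simp)
    · by_cases hw'' : w = (y, false)
      · rw [hw'', Function.update_self]
      · rw [hu w (by simp only [List.mem_append]; tauto)]
        exact h.right w (by simp only [List.mem_append, List.mem_cons]; tauto)
  · rw [Function.update_of_ne, swapBoxes_of_ne] <;> rintro rfl <;> simp at h₁ h₂

theorem Fills.diagonal_pair_swap {xs P R D : List ((ℕ × ℕ) × Bool)} {x y z : ℕ × ℕ}
    (h : Fills a b T₀ T (xs ++ [(x, false)] ++ (y, false) :: D) (P ++ (z, false) :: R))
    (hn : (boxes (xs ++ [(x, false)]) ++ (boxes P ++ y :: (z :: boxes R ++ boxes D))).Nodup) :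
    Fills a b T₀ (Function.update (swapBoxes T x z) y (some ⟨a, true⟩))
      (xs ++ (y, true) :: (z, false) :: D) (P ++ [(x, false)] ++ R) := by
  have hn' : (x :: y :: z :: (boxes xs ++ boxes D ++ boxes P ++ boxes R)).Nodup := by
    refine (List.Perm.nodup_iff ?_).1 hn
    simp only [List.map_append, List.map_cons, List.map_nil, ← Multiset.coe_eq_coe,
      ← Multiset.coe_add, ← Multiset.cons_coe, Multiset.cons_add, Multiset.add_cons,
      Multiset.coe_nil, add_zero]
    rw [Multiset.cons_swap x y, Multiset.cons_swap x z]
    congr 3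
    abel
  simp only [List.nodup_cons, List.mem_cons, not_or] at hn'
  have hx : ∀ w ∈ xs ++ D ++ P ++ R, w.1 ≠ x ∧ w.1 ≠ y ∧ w.1 ≠ z := by
    intro w hw
    have hw' : w.1 ∈ boxes xs ++ boxes D ++ boxes P ++ boxes R := by
      simpa only [List.map_append] using List.mem_map_of_mem (f := Prod.fst) hw
    refine ⟨?_, ?_, ?_⟩ <;> rintro rfl
    · exact hn'.1.2.2 hw'
    · exact hn'.2.1.2 hw'
    · exact hn'.2.2.1 hw'
  have hu : ∀ w ∈ xs ++ D ++ P ++ R,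
      Function.update (swapBoxes T x z) y (some ⟨a, true⟩) w.1 = T w.1 := fun w hw => by
    have := hx w hw
    rw [Function.update_of_ne this.2.1, swapBoxes_of_ne this.1 this.2.2]
  refine h.change ?_ (fun w hw => ?_) (fun w hw => ?_) (fun p h₁ h₂ => ?_)
  · simp only [List.map_append, List.map_cons, List.map_nil, ← Multiset.coe_eq_coe,
      ← Multiset.coe_add, ← Multiset.cons_coe, Multiset.cons_add, Multiset.add_cons,
      Multiset.coe_nil, add_zero]
    rw [Multiset.cons_swap y x, Multiset.cons_swap z x, Multiset.cons_swap z y]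
  · simp only [List.mem_append, List.mem_cons] at hw
    by_cases hw' : w = (y, true)
    · rw [hw', Function.update_self]
    · by_cases hw'' : w = (z, false)
      · rw [hw'', Function.update_of_ne (Ne.symm hn'.2.1.1), swapBoxes_right]
        exact h.left (x, false) (by simp)
      · rw [hu w (by simp only [List.mem_append]; tauto)]
        exact h.left w (by simp only [List.mem_append, List.mem_cons]; tauto)
  · simp only [List.mem_append, List.mem_cons, List.not_mem_nil, or_false] at hw
    by_cases hw' : w = (x, false)
    · rw [hw', Function.update_of_ne hn'.1.1, swapBoxes_left]
      exact h.right (z, false) (by simp)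
    · rw [hu w (by simp only [List.mem_append]; tauto)]
      exact h.right w (by simp only [List.mem_append, List.mem_cons]; tauto)
  · rw [Function.update_of_ne, swapBoxes_of_ne] <;> rintro rfl <;> simp at h₁ h₂

/-- The switching process leads from `T` to the second filling. -/
inductive Run (a b : Fin n) : Filling n → Filling n → Prop
  | done {T : Filling n} : FullySwitched a b T → Run a b T T
  | step {T T' : Filling n} : ¬ FullySwitched a b T → Run a b (switchStep a b T) T' → Run a b T T'

/-- A run steps only from fillings that are not fully switched, so its length is the least number of
steps in the definition of `SP`. -/
theorem Run.sp_eq {T' : Filling n} (h : Run a b T T') : SP a b T = T' := by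
  obtain ⟨k, hk, hfs, rfl⟩ : ∃ k, (∀ j < k, ¬ FullySwitched a b ((switchStep a b)^[j] T)) ∧
      FullySwitched a b ((switchStep a b)^[k] T) ∧ (switchStep a b)^[k] T = T' := by
    induction h with
    | done h => exact ⟨0, by simp, h, rfl⟩
    | step h _ ih =>
      obtain ⟨k, hk, hfs, he⟩ := ih
      refine ⟨k + 1, fun j hj => ?_, hfs, he⟩
      cases j with
      | zero => exact h
      | succ j => exact hk j (by omega)
  classical
  have hex : ∃ m, FullySwitched a b ((switchStep a b)^[m] T) := ⟨k, hfs⟩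
  have : Nat.find hex = k := (Nat.find_eq_iff hex).2 ⟨hfs, hk⟩
  rw [SP, dif_pos hex]
  convert rfl using 2
  rw [← this]

theorem switchStep_eq {p : ℕ × ℕ} (hp : Selected a b T p)
    (hu : ∀ q, Selected a b T q → q = p) : switchStep a b T = switchAt a b T p := by
  have hex : ∃ p, Selected a b T p := ⟨p, hp⟩
  rw [switchStep, dif_pos hex, hu _ hex.choose_spec]

theorem Fills.fullySwitched (h : Fills a b T₀ T A B) (hab : a ≠ b)
    (hg : Good (boxes B ++ boxes A)) : FullySwitched a b T := by
  rintro p ⟨hp, hq⟩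
  simp only [h.hasLetter_left hab, h.hasLetter_right hab] at hp hq
  have := (List.pairwise_append.1 hg.lin).2.2
  rcases hq with hq | hq
  · exact this _ hq _ hp (by simp [Prod.le_def])
  · exact this _ hq _ hp (by simp [Prod.le_def])

/-! ### The selected box and the switch applied to it, matched with the growth diagram. -/

section
variable {xs P R D : List ((ℕ × ℕ) × Bool)} {x y : ℕ × ℕ} {f g : Bool}

/-- Boxes of `D` come after all inward boxes and cannot be switched. Boxes of `xs` precede the start
of `x` in the standardisation, and `x` has since moved only right and down. So the selection rule
picks `x`. -/
theorem Inv.switchable_cases (hI : Inv xs P x f R D)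
    (hF : Fills a b T₀ T (xs ++ (x, f) :: D) (P ++ R)) (hab : a ≠ b) {q : ℕ × ℕ} {k : Bool}
    (hq : T q = some ⟨a, k⟩) (hs : Switchable a b T q) :
    (q = x ∧ k = f) ∨ (k = true ∧ (f = true → q.1 < x.1)) ∨
      (k = false ∧ f = false ∧ q.2 < x.2) := by
  rw [hF.eq_left hab, List.mem_append, List.mem_cons] at hq
  rcases hq with hq | hq | hq
  · obtain ⟨x₀, P₀, hr, -, hp, -⟩ := hI.pre
    have hle := hr.le
    rw [Prod.le_def] at hle
    rcases hp.relTrans hq with h | h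
    · exact .inr (.inl ⟨h.1, fun hf => (h.2 hf).1.trans_le hle.1⟩)
    · exact .inr (.inr ⟨h.1, h.2.1, h.2.2.1.trans_le hle.2⟩)
  · exact .inl (by simpa using hq)
  · exfalso
    have hl := hI.good.lin
    have hqD := List.mem_map_of_mem (f := Prod.fst) hq
    simp only [List.pairwise_append, List.pairwise_cons] at hl
    have key : ∀ w ∈ boxes (P ++ R), ¬ q ≤ w := by
      intro w hw
      rw [List.map_append, List.mem_append] at hw
      rcases hw with hw | hw
      · exact hl.2.1.2.2 w hw q (by simp only [List.mem_cons, List.mem_append]; tauto)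
      · exact hl.2.1.2.1.2.2.2 w hw q hqD
    rcases hs.2 with h | h <;> rw [hF.hasLetter_right hab] at h <;>
      exact key _ h (by simp [Prod.le_def])

theorem Inv.switchStep_eq (hI : Inv xs P x f R D)
    (hF : Fills a b T₀ T (xs ++ (x, f) :: D) (P ++ R)) (hab : a ≠ b)
    (hs : Switchable a b T x) :
    ¬ FullySwitched a b T ∧ switchStep a b T = switchAt a b T x := by
  have hx : T x = some ⟨a, f⟩ := hF.left (x, f) (by simp)
  have hc := fun q k => hI.switchable_cases hF hab (q := q) (k := k)
  refine ⟨fun h => h x hs, ShiftedBK.switchStep_eq ⟨hs, ?_⟩ fun q hq => ?_⟩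
  · cases f with
    | false =>
      refine .inl ⟨hx, fun q hq hqs => ?_⟩
      rcases hc q _ hq hqs with h | h | h
      · rw [h.1]
      · simp at h
      · exact h.2.2.le
    | true =>
      refine .inr ⟨fun q hq hqs => ?_, hx, fun q hq hqs => ?_⟩ <;>
        rcases hc q _ hq hqs with h | h | h <;> simp_all
      exact h.le
  · obtain ⟨hqs, ⟨hq, hmax⟩ | ⟨hn, hq, hmax⟩⟩ := hq
    · rcases hc q _ hq hqs with h | h | h
      · exact h.1
      · simp at h
      · obtain rfl := h.2.1
        have := hmax x hx hs
        omega
    · rcases hc q _ hq hqs with h | h | h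
      · exact h.1
      · cases f with
        | false => exact absurd hs (hn x hx)
        | true =>
          have := hmax x hx hs
          have := h.2 rfl
          omega
      · simp at h

theorem Inv.mem_of_le (hI : Inv xs P x f ((y, g) :: R) D) {w : ℕ × ℕ}
    (hw : w ∈ boxes (P ++ (y, g) :: R)) (hne : w ≠ y) (hle : x ≤ w) : w ∈ boxes R := by
  have hl := hI.good.lin
  simp only [List.pairwise_append, List.pairwise_cons] at hl
  simp only [List.map_append, List.map_cons, List.mem_append, List.mem_cons] at hw
  rcases hw with hw | hw | hw
  · exact absurd hle (hl.2.1.2.2 w hw x (by simp))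
  · exact absurd hw hne
  · exact hw

theorem Inv.relTrans (hI : Inv xs P x f ((y, g) :: R) D) {w : (ℕ × ℕ) × Bool} (hw : w ∈ R) :
    RelTrans (y, g) w :=
  (List.pairwise_cons.1 (pairwise_of_isChain (vshape_append.1 hI.vshape).2.isChain)).1 w hw

theorem Inv.nodup (hI : Inv xs P x f R D) :
    (boxes xs ++ (boxes P ++ x :: (boxes R ++ boxes D))).Nodup := hI.good.nodup

/-- A box on the main diagonal to the left of `x` is the last box not yet moved. -/
theorem Inv.eq_snoc {r : ℕ} (hI : Inv xs P (r, r + 1) f R D)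
    (hm : (r, r) ∈ boxes (xs ++ ((r, r + 1), f) :: D)) : ∃ xs' k, xs = xs' ++ [((r, r), k)] := by
  have hg := hI.good
  have hl := hg.lin
  simp only [List.pairwise_append, List.pairwise_cons] at hl
  simp only [List.map_append, List.map_cons, List.mem_append, List.mem_cons] at hm
  rcases hm with hm | hm | hm
  · obtain ⟨k, hk⟩ := mem_boxes.1 hm
    obtain ⟨A₁, A₂, rfl⟩ := List.append_of_mem hk
    cases A₂ with
    | nil => exact ⟨_, _, rfl⟩
    | cons w A₂ =>
      exfalso
      obtain ⟨x₀, P₀, hr, -, hp, -⟩ := hI.pre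
      have hle := hr.le
      rw [Prod.le_def] at hle
      have hw := hp.relTrans (z := w) (by simp)
      have hrel : Rel ((r, r), k) w := by
        rw [Pre, List.append_assoc, List.isChain_append] at hp
        exact (List.isChain_cons_cons.1 hp.2.1).1
      obtain ⟨-, h₁, h₂⟩ := hrel.flag_of_diagonal (hg.box w.1 (by simp))
      -- `w` would lie strictly between the columns `r` and `r + 1`.
      rcases hw with hw | hw
      · simp_all
      · have := hw.2.2
        simp only [Rt] at h₂ this
        omega
  · simp at hm
  · exact absurd (by simp [Prod.le_def]) (hl.2.1.2.1.1 (r, r) (by simp [hm]))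

/-- The switch that applies to the present box `x`, as a step of the growth diagram. -/
theorem Inv.switch (hI : Inv xs P x f ((y, g) :: R) D)
    (hF : Fills a b T₀ T (xs ++ (x, f) :: D) (P ++ (y, g) :: R)) (hab : a ≠ b) (hadj : Adj x y) :
    (Inv xs (P ++ [(x, g)]) y f R D ∧
      Fills a b T₀ (switchAt a b T x) (xs ++ (y, f) :: D) (P ++ [(x, g)] ++ R)) ∨
    (∃ r R', x = (r, r) ∧ y = (r, r + 1) ∧ R = ((r + 1, r + 1), false) :: R' ∧
      Inv xs (P ++ [(x, false), (y, false)]) (r + 1, r + 1) f R' D ∧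
      Fills a b T₀ (switchAt a b T x) (xs ++ ((r + 1, r + 1), f) :: D)
        (P ++ [(x, false), (y, false)] ++ R')) ∨
    (∃ r xs', x = (r, r + 1) ∧ y = (r + 1, r + 1) ∧ xs = xs' ++ [((r, r), false)] ∧
      Row y (boxes R) (boxes R) y ∧ Row (r, r) (boxes P) (boxes P) (r, r) ∧
      Inv xs' (P ++ [((r, r), false)]) x true R ((y, false) :: D) ∧
      Fills a b T₀ (switchAt a b T x) (xs' ++ (x, true) :: (y, false) :: D)
        (P ++ [((r, r), false)] ++ R)) := by
  have hB := fun p => hF.hasLetter_right hab (p := p)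
  have hA := fun p => hF.hasLetter_left hab (p := p)
  have hx : T x = some ⟨a, f⟩ := hF.left (x, f) (by simp)
  have hy : T y = some ⟨b, g⟩ := hF.right (y, g) (by simp)
  have hyB : HasLetter T b y := ⟨_, hy, rfl⟩
  have hnd := hI.nodup
  have hg := hI.good
  have hbR : ∀ w ∈ boxes R, w.1 ≤ w.2 := fun w hw => hg.box w (by simp_all)
  rcases hadj with rfl | rfl
  · by_cases hbelow : HasLetter T b (x.1 + 1, x.2)
    · left
      obtain ⟨k, hk⟩ := mem_boxes.1 (hI.mem_of_le ((hB _).1 hbelow) (by simp [Prod.ext_iff])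
        (by simp [Prod.le_def]))
      -- When there are `b`-neighbours on the right and below, the right one comes first in the list
      -- only if it is primed. This is what separates (S5) from (S6) and (S7).
      have hgt : g = true := by
        rcases hI.relTrans hk with h | h
        · exact h.1
        · have := h.2.2.1
          simp at this
      have hsw : switchAt a b T x = swapBoxes T x (x.1, x.2 + 1) := by
        simp only [switchAt]
        rw [if_pos ⟨hyB, hbelow⟩, if_pos (by rw [hy, hgt])]
      rw [hsw]
      refine ⟨hI.step (.move (.inl rfl)) (fun u _ r _ h => ?_) (fun r h => ?_), hF.swap hnd⟩
      · simp [h]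
      · have := hbR _ (mem_boxes.2 ⟨k, hk⟩)
        simp [h] at this
    · by_cases hc : x.1 = x.2 ∧ T (x.1, x.2 + 1) = some ⟨b, true⟩ ∧
          HasLetter T b (x.1 + 1, x.2 + 1)
      · right; left
        obtain ⟨hd, hc₂, hc₃⟩ := hc
        have hsw : switchAt a b T x = Function.update (swapBoxes T x (x.1 + 1, x.2 + 1))
            (x.1, x.2 + 1) (some ⟨b, false⟩) := by
          simp only [switchAt]
          rw [if_neg (fun h => hbelow h.2), if_pos hyB, if_pos ⟨hd, hc₂, hc₃⟩]
        obtain rfl : g = true := by simpa [hy] using hc₂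
        obtain ⟨r, c⟩ := x
        obtain rfl : r = c := hd
        obtain ⟨R', rfl, hI'⟩ := hI.diagonal_step
        rw [hsw]
        exact ⟨r, R', rfl, rfl, rfl, hI', hF.diagonal_swap hnd⟩
      · left
        have hsw : switchAt a b T x = swapBoxes T x (x.1, x.2 + 1) := by
          simp only [switchAt]
          rw [if_neg (fun h => hbelow h.2), if_pos hyB, if_neg hc]
        rw [hsw]
        refine ⟨hI.step (.move (.inl rfl)) (fun u _ r _ h => ?_) (fun r h _ => ?_), hF.swap hnd⟩
        · simp [h]
        · subst h
          -- A primed box at `(r, r + 1)` is followed by `(r + 1, r + 1)`, so (S3) would apply.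
          by_contra hgt
          obtain rfl : g = true := by simpa using hgt
          obtain ⟨R', rfl, -⟩ := hI.diagonal_step
          exact hc ⟨rfl, hy, (hB _).2 (by simp)⟩
  -- Conversely, a primed right neighbour cannot come after the lower neighbour in the list.
  · have hright : T (x.1, x.2 + 1) ≠ some ⟨b, true⟩ := by
      intro h
      have hm : HasLetter T b (x.1, x.2 + 1) := ⟨_, h, rfl⟩
      obtain ⟨k, hk⟩ := mem_boxes.1 (hI.mem_of_le ((hB _).1 hm) (by simp [Prod.ext_iff])
        (by simp [Prod.le_def]))
      have : T (x.1, x.2 + 1) = some ⟨b, k⟩ := hF.right ((x.1, x.2 + 1), k) (by simp [hk])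
      obtain rfl : k = true := by simpa [this] using h
      rcases hI.relTrans hk with h | h
      · have := (h.2 rfl).1
        simp at this
      · simp at h
    by_cases hc : x.2 = x.1 + 1 ∧ T x = some ⟨a, false⟩ ∧ HasLetter T a (x.1, x.1)
    · right; right
      have hsw : switchAt a b T x = Function.update (swapBoxes T (x.1, x.1) (x.1 + 1, x.2)) x
          (some ⟨a, true⟩) := by
        simp only [switchAt]
        by_cases hr : HasLetter T b (x.1, x.2 + 1)
        · rw [if_pos ⟨hr, hyB⟩, if_neg hright, if_pos hc]
        · rw [if_neg (fun h => hr h.1), if_neg hr, if_pos hyB, if_pos hc]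
      obtain ⟨hd, hc₂, hc₃⟩ := hc
      obtain ⟨r, c⟩ := x
      obtain rfl : c = r + 1 := hd
      obtain ⟨xs', k, rfl⟩ := hI.eq_snoc ((hA _).1 hc₃)
      obtain ⟨rfl, rfl, rfl⟩ := hI.diagonal_flags
      obtain ⟨hrow, hI'⟩ := hI.diagonal_pair_step
      rw [hsw]
      exact ⟨r, xs', rfl, rfl, rfl, hI.row_of_diagonal, hrow, hI', hF.diagonal_pair_swap hnd⟩
    · left
      have hsw : switchAt a b T x = swapBoxes T x (x.1 + 1, x.2) := by
        simp only [switchAt]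
        by_cases hr : HasLetter T b (x.1, x.2 + 1)
        · rw [if_pos ⟨hr, hyB⟩, if_neg hright, if_neg hc]
        · rw [if_neg (fun h => hr h.1), if_neg hr, if_pos hyB, if_neg hc]
      rw [hsw]
      refine ⟨hI.step (.move (.inr rfl)) (fun u hu r hur h _ => ?_) (fun r h h' => ?_), hF.swap hnd⟩
      · subst h
        obtain ⟨xs', rfl⟩ : ∃ xs', xs = xs' ++ [u] := by
          rw [Option.mem_def, List.getLast?_eq_some_iff] at hu
          exact hu
        obtain ⟨u, k⟩ := u
        obtain rfl : u = (r, r) := hur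
        obtain ⟨rfl, rfl, rfl⟩ := hI.diagonal_flags
        exact hc ⟨rfl, hx, (hA _).2 (by simp)⟩
      · simp [h] at h'

/-- The switching process follows the growth diagram. -/
theorem Inv.run (hab : a ≠ b) : ∀ (N M : ℕ) {xs P R D : List ((ℕ × ℕ) × Bool)} {x : ℕ × ℕ}
    {f : Bool} {T : Filling n}, xs.length = N → R.length = M → Inv xs P x f R D →
    Fills a b T₀ T (xs ++ (x, f) :: D) (P ++ R) →
    ∃ R₁ x₁ Xp T' A B, Run a b T T' ∧ Row x (boxes R) R₁ x₁ ∧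
      Grid (boxes xs) (boxes P ++ R₁) (boxes B) Xp ∧ boxes A = Xp ++ x₁ :: boxes D ∧
      VShape A ∧ VShape B ∧ Fills a b T₀ T' A B ∧ Good (boxes B ++ boxes A) := by
  -- The induction is lexicographic: once a box is done, the next one has the whole inward list
  -- before it again.
  intro N
  induction N using Nat.strong_induction_on with
  | _ N ihN =>
  intro M
  induction M using Nat.strong_induction_on with
  | _ M ihM =>
  intro xs P R D x f T hN hM hI hF
  cases R with
  | nil =>
    rcases List.eq_nil_or_concat xs with rfl | ⟨xs, z, rfl⟩
    · have hg : Good (boxes P ++ boxes ((x, f) :: D)) := by simpa using hI.good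
      exact ⟨[], x, [], T, (x, f) :: D, P, .done (Fills.fullySwitched (by simpa using hF) hab hg),
        .nil _, by simpa using Grid.nil _, by simp, hI.suf.vshape, by simpa using hI.vshape,
        by simpa using hF, hg⟩
    · rw [List.concat_eq_append] at *
      obtain ⟨R₁, x₁, Xp, T', A, B, hrun, hrow, hgrid, hA, h⟩ :=
        ihN xs.length (by simp at hN; omega) _ rfl rfl hI.next (by simpa using hF)
      refine ⟨[], x, Xp ++ [x₁], T', A, B, hrun, .nil _, ?_, by simpa using hA, h⟩
      simpa using Grid.snoc hrow hgrid
  | cons yg R =>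
    obtain ⟨y, g⟩ := yg
    by_cases hadj : Adj x y
    · have hs : Switchable a b T x := by
        refine ⟨(hF.hasLetter_left hab).2 (by simp), ?_⟩
        rcases hadj with rfl | rfl
        · exact .inl ((hF.hasLetter_right hab).2 (by simp))
        · exact .inr ((hF.hasLetter_right hab).2 (by simp))
      obtain ⟨hnf, hstep⟩ := hI.switchStep_eq hF hab hs
      rcases hI.switch hF hab hadj with ⟨hI', hF'⟩ | ⟨r, R', rfl, rfl, rfl, hI', hF'⟩ |
        ⟨r, xs', rfl, rfl, rfl, hrowR, hrowP, hI', hF'⟩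
      · obtain ⟨R₁, x₁, Xp, T', A, B, hrun, hrow, hgrid, h⟩ :=
          ihM R.length (by simp at hM; omega) hN rfl hI' hF'
        exact ⟨x :: R₁, x₁, Xp, T', A, B, .step hnf (hstep ▸ hrun), .cons (.move hadj) hrow,
          by simpa using hgrid, h⟩
      · obtain ⟨R₁, x₁, Xp, T', A, B, hrun, hrow, hgrid, h⟩ :=
          ihM R'.length (by simp at hM; omega) hN rfl hI' hF'
        exact ⟨(r, r) :: (r, r + 1) :: R₁, x₁, Xp, T', A, B, .step hnf (hstep ▸ hrun),
          .cons (.move hadj) (.cons (.move (.inr rfl)) hrow), by simpa using hgrid, h⟩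
      · obtain ⟨R₁, x₁, Xp, T', A, B, hrun, hrow, hgrid, hA, h⟩ :=
          ihN xs'.length (by simp at hN; omega) _ rfl rfl hI' hF'
        -- This is (S4) or (S7). The row of `x` ends here, as nothing in `R` is adjacent to `(r + 1,
        -- r + 1)`; the row of `(r, r)` is already done up to its square with `(r, r + 1)`.
        refine ⟨(r, r + 1) :: boxes R, (r + 1, r + 1), Xp ++ [x₁], T', A, B,
          .step hnf (hstep ▸ hrun), .cons (.move hadj) hrowR, ?_, by simpa using hA, h⟩
        have hrow' := hrowP.append (.cons (.move (.inl rfl)) hrow)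
        simpa using Grid.snoc hrow' (by simpa using hgrid)
    -- Non-adjacent boxes pass each other in the diagram without a switch; the filling stays the
    -- same.
    · obtain ⟨y', x', hs⟩ := Good.exists_sq (L₁ := boxes xs ++ boxes P) (x := x) (y := y)
        (L₂ := boxes R ++ boxes D) (by simpa using hI.good)
      cases hs with
      | move h => exact absurd h hadj
      | pass h₁ h₂ =>
        have hI' := hI.step (.pass h₁ h₂)
          (fun u _ r _ hx hy => hadj (by subst hx hy; exact .inr rfl))
          (fun r hx hy => absurd (by subst hx hy; exact .inl rfl) hadj)
        obtain ⟨R₁, x₁, Xp, T', A, B, hrun, hrow, hgrid, h⟩ :=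
          ihM R.length (by simp at hM; omega) hN rfl hI' (by simpa using hF)
        exact ⟨y :: R₁, x₁, Xp, T', A, B, hrun, .cons (.pass h₁ h₂) hrow,
          by simpa using hgrid, h⟩

end

end

/-! ### Shifted semistandard tableaux and their standardisations -/

section
variable {n : ℕ} {l m : StrictPartition} {T : Filling n}

/-- Because positive parts decrease strictly, the row ends `r + l.part r` decrease weakly there;
going up never leaves the shape on the right. -/
theorem shiftedShape_down {p q : ℕ × ℕ} (hq : q ∈ shiftedShape l) (hp : p.1 ≤ p.2)
    (hpq : p ≤ q) : p ∈ shiftedShape l := by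
  obtain ⟨hpq₁, hpq₂⟩ := hpq
  obtain ⟨hq₁, hq₂⟩ := hq
  have key : ∀ k, p.1 + k ≤ q.1 → q.2 < (q.1 - k) + l.part (q.1 - k) := by
    intro k
    induction k with
    | zero => exact fun _ => hq₂
    | succ k ih =>
      intro hk
      have h₁ := ih (by omega)
      have h₂ := l.strict (q.1 - (k + 1))
      rw [show q.1 - (k + 1) + 1 = q.1 - k by omega] at h₂
      omega
  have := key (q.1 - p.1) (by omega)
  rw [show q.1 - (q.1 - p.1) = p.1 by omega] at this
  exact ⟨hp, by omega⟩

theorem skewShape_conv {p q s : ℕ × ℕ} (hp : p ∈ skewShape l m) (hq : q ∈ skewShape l m)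
    (hs : s.1 ≤ s.2) (hps : p ≤ s) (hsq : s ≤ q) : s ∈ skewShape l m :=
  ⟨shiftedShape_down hq.1 hs hsq, fun h => hp.2 (shiftedShape_down h hp.1.1 hps)⟩

theorem skewShape_finite : (skewShape l m).Finite := by
  refine ((Set.finite_Iio (l.part 0)).prod (Set.finite_Iio (l.part 0))).subset fun p hp => ?_
  have h := (shiftedShape_down (p := (0, p.2)) hp.1 (by simp) ⟨by simp, le_rfl⟩).2
  have h' := hp.1.1
  simp only [zero_add] at h
  exact ⟨by simp only [Set.mem_Iio]; omega, by simpa using h⟩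

theorem letter_le_iff {x y : Letter n} :
    x ≤ y ↔ x.val < y.val ∨ (x.val = y.val ∧ (x.primed = true ∨ y.primed = false)) := Iff.rfl

theorem letter_le_trans {x y z : Letter n} (h₁ : x ≤ y) (h₂ : y ≤ z) : x ≤ z := by
  rw [letter_le_iff] at *
  rcases hx : x.primed <;> rcases hy : y.primed <;> rcases hz : z.primed <;> simp_all <;> omega

theorem letter_le_refl (x : Letter n) : x ≤ x := by
  rw [letter_le_iff]
  rcases x.primed <;> simp

theorem IsSemistandard.mem_shape (hT : IsSemistandard l m T) {p : ℕ × ℕ} {x : Letter n}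
    (h : T p = some x) : p ∈ skewShape l m := (hT.shape p).1 (by simp [h])

theorem IsSemistandard.box (hT : IsSemistandard l m T) {p : ℕ × ℕ} {x : Letter n}
    (h : T p = some x) : p.1 ≤ p.2 := (hT.mem_shape h).1.1

theorem IsSemistandard.exists_of_between (hT : IsSemistandard l m T) {p q s : ℕ × ℕ}
    {x y : Letter n} (hp : T p = some x) (hq : T q = some y) (hs : s.1 ≤ s.2) (hps : p ≤ s)
    (hsq : s ≤ q) : ∃ z, T s = some z :=
  Option.isSome_iff_exists.1
    ((hT.shape s).2 (skewShape_conv (hT.mem_shape hp) (hT.mem_shape hq) hs hps hsq))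

theorem IsSemistandard.mono (hT : IsSemistandard l m T) {p q : ℕ × ℕ} {x y : Letter n}
    (hp : T p = some x) (hq : T q = some y) (hpq : p ≤ q) : x ≤ y := by
  have hbp := hT.box hp
  obtain ⟨r, c⟩ := p
  obtain ⟨s, d⟩ := q
  obtain ⟨h₁, h₂⟩ := hpq
  simp only at h₁ h₂ hbp
  obtain ⟨z, hz⟩ := hT.exists_of_between (s := (r, d)) hp hq (by simp; omega) ⟨le_rfl, h₂⟩
    ⟨h₁, le_rfl⟩
  have hxz : x ≤ z := by
    rcases h₂.eq_or_lt with rfl | h₂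
    · obtain rfl : x = z := by simpa [hp] using hz
      exact letter_le_refl x
    · exact hT.row_weak _ _ _ _ _ h₂ hp hz
  have hzy : z ≤ y := by
    rcases h₁.eq_or_lt with rfl | h₁
    · obtain rfl : y = z := by simpa [hq] using hz
      exact letter_le_refl y
    · exact hT.col_weak _ _ _ _ _ h₁ hz hq
  exact letter_le_trans hxz hzy

/-- The boxes with one letter form a border strip. -/
theorem IsSemistandard.not_diagonal (hT : IsSemistandard l m T) {p q : ℕ × ℕ} {k : Fin n}
    {g g' : Bool} (hp : T p = some ⟨k, g⟩) (hq : T q = some ⟨k, g'⟩) (h₁ : p.1 < q.1) :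
    q.2 ≤ p.2 := by
  by_contra h₂
  push Not at h₂
  have hbp := hT.box hp
  obtain ⟨r, c⟩ := p
  obtain ⟨s, d⟩ := q
  simp only at h₁ h₂ hbp
  -- The upper right corner of the rectangle carries the same number: primed, it repeats `k'` in a
  -- row; unprimed, it repeats `k` in a column.
  obtain ⟨⟨k', h⟩, hz⟩ := hT.exists_of_between (s := (r, d)) hp hq (by simp; omega)
    ⟨le_rfl, h₂.le⟩ ⟨h₁.le, le_rfl⟩
  have l₁ := hT.row_weak _ _ _ _ _ h₂ hp hz
  have l₂ := hT.col_weak _ _ _ _ _ h₁ hz hq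
  rw [letter_le_iff] at l₁ l₂
  simp only at l₁ l₂
  obtain rfl : k' = k := by omega
  simp only [lt_irrefl, true_and, false_or] at l₁ l₂
  cases h with
  | true =>
    obtain rfl : g = true := by simpa using l₁
    exact h₂.ne (hT.row_primed _ _ _ _ hp hz)
  | false =>
    obtain rfl : g' = false := by simpa using l₂
    exact h₁.ne (hT.col_unprimed _ _ _ _ hz hq)

/-- Meant for the row index on the primed boxes of one letter and the column index on its unprimed
boxes, where semistandardness gives injectivity. -/
theorem exists_list_of_injOn {s : Set (ℕ × ℕ)} (hs : s.Finite) {g : ℕ × ℕ → ℕ}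
    (hg : s.InjOn g) : ∃ L : List (ℕ × ℕ), (∀ p, p ∈ L ↔ p ∈ s) ∧
      L.Pairwise fun p q => g p < g q := by
  classical
  have hinv : ∀ k ∈ (hs.toFinset.image g).sort (· ≤ ·),
      Function.invFunOn g s k ∈ s ∧ g (Function.invFunOn g s k) = k := fun k hk => by
    have hk' : k ∈ g '' s := by simpa using hk
    exact ⟨Function.invFunOn_mem hk', Function.invFunOn_eq hk'⟩
  refine ⟨((hs.toFinset.image g).sort (· ≤ ·)).map (Function.invFunOn g s), fun p => ?_, ?_⟩
  · rw [List.mem_map]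
    constructor
    · rintro ⟨k, hk, rfl⟩
      exact (hinv k hk).1
    · intro hp
      have hk : g p ∈ (hs.toFinset.image g).sort (· ≤ ·) := by simpa using ⟨p.1, p.2, hp, rfl⟩
      exact ⟨g p, hk, hg (hinv _ hk).1 hp (hinv _ hk).2⟩
  · rw [List.pairwise_map]
    refine List.Pairwise.imp_of_mem (fun {k j} hk hj h => ?_)
      (Finset.sortedLT_sort (hs.toFinset.image g)).pairwise
    rw [(hinv k hk).2, (hinv j hj).2]
    exact h

theorem exists_isFirst {k : Fin n} (hfin : {p | HasLetter T k p}.Finite)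
    (hne : {p | HasLetter T k p}.Nonempty) : ∃ p, IsFirst T k p := by
  obtain ⟨p, hp, hmax⟩ := Set.exists_max_image _ (fun p : ℕ × ℕ => p.1) hfin hne
  obtain ⟨q, hq, hmin⟩ := Set.exists_min_image ({p | HasLetter T k p} ∩ {q | q.1 = p.1})
    (fun p : ℕ × ℕ => p.2) (hfin.inter_of_left _) ⟨p, hp, rfl⟩
  refine ⟨q, hq.1, fun w hw h => ?_⟩
  have h₁ := hmax w hw
  have h₂ : q.1 = p.1 := hq.2
  rcases h with h | ⟨h, h'⟩
  · omega
  · have := hmin w ⟨hw, h.trans h₂⟩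
    omega

theorem vshape_of_rt {L : List (ℕ × ℕ)} (h : L.Pairwise Rt) :
    VShape (L.map fun p => (p, false)) := by
  induction L with
  | nil => trivial
  | cons p L ih =>
    cases L with
    | nil => rfl
    | cons q L =>
      rw [List.pairwise_cons] at h
      exact ⟨.inr ⟨rfl, rfl, h.1 q (by simp)⟩, ih h.2⟩

theorem vshape_of_down {L : List (ℕ × ℕ)} {w : (ℕ × ℕ) × Bool} {W : List ((ℕ × ℕ) × Bool)}
    (h : L.Pairwise Down) (hw : ∀ p ∈ L, Down p w.1) (hW : VShape (w :: W)) :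
    VShape ((L.map fun p => (p, true)) ++ w :: W) := by
  induction L with
  | nil => exact hW
  | cons p L ih =>
    rw [List.pairwise_cons] at h
    have := ih h.2 fun q hq => hw q (by simp [hq])
    cases L with
    | nil => exact ⟨.inl ⟨rfl, hw p (by simp)⟩, this⟩
    | cons q L => exact ⟨.inl ⟨rfl, h.1 q (by simp)⟩, this⟩

theorem canonical_flag (hc : canonicalize T = T) {p : ℕ × ℕ} {k : Fin n} {g : Bool}
    (hp : T p = some ⟨k, g⟩) (hf : IsFirst T k p) : g = false := by
  have := congrFun hc p
  rw [canonicalize, hp, Option.map_some, if_pos hf] at this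
  simpa using this.symm

/-- The standardisation of the boxes with the letters `k`, `k'`. -/
theorem exists_standardisation (hT : T ∈ ShST l m n) (k : Fin n) :
    ∃ A, VShape A ∧ (∀ p g, (p, g) ∈ A ↔ T p = some ⟨k, g⟩) ∧
      (boxes A).Pairwise fun p q => ¬ q ≤ p := by
  obtain ⟨hT, hc⟩ := hT
  have hfin : ∀ g, {p | T p = some ⟨k, g⟩}.Finite := fun g =>
    skewShape_finite.subset fun p hp => hT.mem_shape hp
  obtain ⟨us, hus, hus'⟩ := exists_list_of_injOn (hfin true) (g := Prod.fst) (by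
    rintro ⟨r, c⟩ h₁ ⟨s, d⟩ h₂ (rfl : r = s)
    rw [hT.row_primed _ _ _ _ h₁ h₂])
  obtain ⟨vs, hvs, hvs'⟩ := exists_list_of_injOn (hfin false) (g := Prod.snd) (by
    rintro ⟨r, c⟩ h₁ ⟨s, d⟩ h₂ (rfl : c = d)
    rw [hT.col_unprimed _ _ _ _ h₁ h₂])
  have hmem : ∀ p g, (p, g) ∈ us.map (fun p => (p, true)) ++ vs.map (fun p => (p, false)) ↔
      T p = some ⟨k, g⟩ := by
    intro p g
    have h₁ := hus p
    have h₂ := hvs p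
    simp only [Set.mem_ofPred_eq] at h₁ h₂
    cases g <;> simp [h₁, h₂]
  have hdown : us.Pairwise Down := hus'.imp_of_mem fun {p q} hp hq h =>
    ⟨h, hT.not_diagonal ((hus p).1 hp) ((hus q).1 hq) h⟩
  have hrt : vs.Pairwise Rt := hvs'.imp_of_mem fun {p q} hp hq h =>
    ⟨h, not_lt.1 fun h' => h.not_ge (hT.not_diagonal ((hvs p).1 hp) ((hvs q).1 hq) h')⟩
  refine ⟨_, ?_, hmem, ?_⟩
  · have hfin' : {p | HasLetter T k p}.Finite := skewShape_finite.subset fun p hp => by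
      obtain ⟨x, hx, -⟩ := hp
      exact hT.mem_shape hx
    have hfirst : ∀ p g, T p = some ⟨k, g⟩ → ∃ w, IsFirst T k w ∧ w ∈ vs := by
      intro p g hp
      obtain ⟨w, hw⟩ := exists_isFirst hfin' ⟨p, _, hp, rfl⟩
      obtain ⟨g', hg'⟩ := hasLetter_iff.1 hw.1
      obtain rfl := canonical_flag hc hg' hw
      exact ⟨w, hw, (hvs w).2 hg'⟩
    cases vs with
    | nil =>
      cases us with
      | nil => trivial
      | cons u us =>
        obtain ⟨w, -, hw⟩ := hfirst u true ((hus u).1 (by simp))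
        simp at hw
    | cons v vs =>
      refine vshape_of_down hdown (fun u hu => ?_) (vshape_of_rt hrt)
      have hv := (hvs v).1 (by simp)
      have hu' := (hus u).1 hu
      obtain ⟨w, hw, hwv⟩ := hfirst v false hv
      -- The first box of the reading word is unprimed by canonicity, and among unprimed boxes the
      -- leftmost is read first.
      obtain rfl : w = v := by
        by_contra hne
        have := (List.pairwise_cons.1 hrt).1 w (by simpa [hne] using hwv)
        refine hw.2 v ⟨_, hv, rfl⟩ ?_
        simp only [Rt] at this
        rcases this.2.lt_or_eq with h | h
        · exact .inl h
        · exact .inr ⟨h.symm, this.1⟩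
      have hnb := hw.2 u ⟨_, hu', rfl⟩
      simp only [ReadsBefore, not_or, not_and] at hnb
      -- In the row of `w`, a primed letter would stand on its right, against the weak increase.
      have hlt : u.1 < w.1 := by
        by_contra hlt
        have he : u.1 = w.1 := by omega
        have hle : w ≤ u := ⟨he.ge, by simpa using hnb.2 he⟩
        have := hT.mono hv hu' hle
        simp [letter_le_iff] at this
      exact ⟨hlt, hT.not_diagonal hu' hv hlt⟩
  · simp only [List.map_append, List.map_map]
    rw [List.pairwise_append]
    refine ⟨?_, ?_, ?_⟩
    · simpa [Function.comp_def] using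
        hdown.imp (S := fun p q => ¬ q ≤ p) fun {p q} h h' => h.1.not_ge (Prod.le_def.1 h').1
    · simpa [Function.comp_def] using
        hrt.imp (S := fun p q => ¬ q ≤ p) fun {p q} h h' => h.1.not_ge (Prod.le_def.1 h').2
    · intro p hp q hq hle
      have := hT.mono ((hvs q).1 (by simpa [Function.comp_def] using hq))
        ((hus p).1 (by simpa [Function.comp_def] using hp)) hle
      simp [letter_le_iff] at this

end

/-- The lists `A` and `B` standardise the boxes of `T` with the letters `a` and `b`. -/
structure Standardises {n : ℕ} (a b : Fin n) (T : Filling n) (A B : List ((ℕ × ℕ) × Bool)) :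
    Prop where
  left : VShape A
  right : VShape B
  good : Good (boxes A ++ boxes B)
  fills : Fills a b T T A B

/-! ### From canonical tableaux to standardisations and back. -/

section
variable {n : ℕ} {l m : StrictPartition} {a b : Fin n} {T₀ T : Filling n}
  {A B : List ((ℕ × ℕ) × Bool)}

theorem fills_self_iff (hab : a ≠ b) : Fills a b T T A B ↔
    (∀ p g, (p, g) ∈ A ↔ T p = some ⟨a, g⟩) ∧ (∀ p g, (p, g) ∈ B ↔ T p = some ⟨b, g⟩) := by
  refine ⟨fun h => ⟨fun p g => (h.eq_left hab).symm, fun p g => (h.eq_right hab).symm⟩,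
    fun h => ⟨fun z hz => (h.1 _ _).1 hz, fun z hz => (h.2 _ _).1 hz, fun p hA hB =>
      ⟨rfl, fun g => ⟨fun hp => ?_, fun hp => ?_⟩⟩⟩⟩
  · exact hA (mem_boxes.2 ⟨g, (h.1 p g).2 hp⟩)
  · exact hB (mem_boxes.2 ⟨g, (h.2 p g).2 hp⟩)

theorem exists_standardises (hT : T ∈ ShST l m n) (hab : (a : ℕ) + 1 = b) :
    ∃ A B, Standardises a b T A B := by
  have hne : a ≠ b := by rintro rfl; omega
  obtain ⟨A, hA, hmA, hlA⟩ := exists_standardisation hT a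
  obtain ⟨B, hB, hmB, hlB⟩ := exists_standardisation hT b
  have hT := hT.1
  have hmem : ∀ p, p ∈ boxes A ++ boxes B ↔ ∃ x : Letter n, T p = some x ∧ a ≤ x.val ∧ x.val ≤ b := by
    intro p
    rw [List.mem_append, mem_boxes, mem_boxes]
    simp only [hmA, hmB]
    constructor
    · rintro (⟨g, h⟩ | ⟨g, h⟩)
      · exact ⟨_, h, le_rfl, by simp only [Fin.le_def]; omega⟩
      · exact ⟨_, h, by simp only [Fin.le_def]; omega, le_rfl⟩
    · rintro ⟨⟨k, g⟩, h, h₁, h₂⟩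
      simp only [Fin.le_def] at h₁ h₂
      obtain h' | h' : k = a ∨ k = b := by omega
      · exact .inl ⟨g, h' ▸ h⟩
      · exact .inr ⟨g, h' ▸ h⟩
  refine ⟨A, B, hA, hB, ⟨?_, fun p hp => ?_, fun p hp q hq s hs hps hsq => ?_⟩,
    (fills_self_iff hne).2 ⟨hmA, hmB⟩⟩
  · refine List.pairwise_append.2 ⟨hlA, hlB, fun p hp q hq hle => ?_⟩
    obtain ⟨g, hp⟩ := mem_boxes.1 hp
    obtain ⟨g', hq⟩ := mem_boxes.1 hq
    have := hT.mono ((hmB _ _).1 hq) ((hmA _ _).1 hp) hle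
    simp only [letter_le_iff] at this
    omega
  · obtain ⟨x, hx, -⟩ := (hmem p).1 hp
    exact hT.box hx
  · obtain ⟨x, hx, hx₁, -⟩ := (hmem p).1 hp
    obtain ⟨y, hy, -, hy₂⟩ := (hmem q).1 hq
    obtain ⟨z, hz⟩ := hT.exists_of_between hx hy hs hps hsq
    have h₁ := hT.mono hx hz hps
    have h₂ := hT.mono hz hy hsq
    rw [letter_le_iff] at h₁ h₂
    exact (hmem s).2 ⟨z, hz, by omega, by omega⟩

theorem VShape.relTrans_or {L : List ((ℕ × ℕ) × Bool)} (h : VShape L) {z w : (ℕ × ℕ) × Bool}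
    (hz : z ∈ L) (hw : w ∈ L) (hne : z ≠ w) : RelTrans z w ∨ RelTrans w z := by
  have : Std.Symm fun z w => RelTrans z w ∨ RelTrans w z := ⟨fun _ _ h => h.symm⟩
  exact ((pairwise_of_isChain h.isChain).imp
    (S := fun z w => RelTrans z w ∨ RelTrans w z) fun h => .inl h).forall hz hw hne

theorem VShape.relTrans_of_le {L : List ((ℕ × ℕ) × Bool)} (h : VShape L)
    (hl : (boxes L).Pairwise fun p q => ¬ q ≤ p) {z w : (ℕ × ℕ) × Bool}
    (hz : z ∈ L) (hw : w ∈ L) (hne : z ≠ w) (hle : z.1 ≤ w.1) : RelTrans z w := by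
  have : Std.Symm fun z w : (ℕ × ℕ) × Bool =>
      (RelTrans z w ∧ ¬ w.1 ≤ z.1) ∨ (RelTrans w z ∧ ¬ z.1 ≤ w.1) := ⟨fun _ _ h => h.symm⟩
  have hp := ((pairwise_of_isChain h.isChain).and (List.pairwise_map.1 hl)).imp
    (S := fun z w => (RelTrans z w ∧ ¬ w.1 ≤ z.1) ∨ (RelTrans w z ∧ ¬ z.1 ≤ w.1))
    fun h => .inl h
  rcases hp.forall hz hw hne with h | h
  · exact h.1
  · exact absurd hle h.2

/-- The last box is unprimed. Every other prime is decided by whether the next box is strictly below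
or weakly above, and these exclude each other. -/
theorem VShape.eq_of_boxes_eq : ∀ {L L' : List ((ℕ × ℕ) × Bool)}, VShape L → VShape L' →
    boxes L = boxes L' → L = L'
  | [], [], _, _, _ => rfl
  | [], _ :: _, _, _, h => by simp at h
  | _ :: _, [], _, _, h => by simp at h
  | [z], [z'], h, h', e => by
    simp only [List.map_cons, List.map_nil, List.cons.injEq, and_true] at e
    rw [Prod.ext e (h.trans h'.symm)]
  | [_], _ :: _ :: _, _, _, h => by simp at h
  | _ :: _ :: _, [_], _, _, h => by simp at h
  | z :: w :: L, z' :: w' :: L', h, h', e => by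
    have hL := VShape.eq_of_boxes_eq h.2 h'.2 (by simpa using (List.cons.inj e).2)
    have hz : z.1 = z'.1 := (List.cons.inj e).1
    obtain ⟨rfl, -⟩ := List.cons.inj hL
    have : z.2 = z'.2 := by
      have h₁ := h.1
      have h₂ := h'.1
      unfold Rel Down Rt at h₁ h₂
      rw [hz] at h₁
      rcases h₁ with h₁ | h₁ <;> rcases h₂ with h₂ | h₂
      · rw [h₁.1, h₂.1]
      · omega
      · omega
      · rw [h₁.1, h₂.1]
    rw [hL, Prod.ext hz this]

theorem Fills.eq_of_ne (h : Fills a b T₀ T A B)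
    (h₀ : ∀ p, p ∈ boxes A ++ boxes B → HasLetter T₀ a p ∨ HasLetter T₀ b p)
    {k : Fin n} (ha : k ≠ a) (hb : k ≠ b) {p : ℕ × ℕ} {g : Bool} : T p = some ⟨k, g⟩ ↔ T₀ p = some ⟨k, g⟩ := by
  by_cases hA : p ∈ boxes A ++ boxes B
  · constructor <;> intro hp <;> exfalso
    · rcases List.mem_append.1 hA with hA | hA
      · obtain ⟨g', hg⟩ := mem_boxes.1 hA
        have := h.left _ hg
        simp_all
      · obtain ⟨g', hg⟩ := mem_boxes.1 hA
        have := h.right _ hg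
        simp_all
    · rcases h₀ p hA with ⟨x, hx, hx'⟩ | ⟨x, hx, hx'⟩ <;> rw [hp] at hx <;> cases hx
      · exact ha hx'
      · exact hb hx'
  · simp only [List.mem_append, not_or] at hA
    rw [(h.off p hA.1 hA.2).1]

/-- Rearranging the boxes with two consecutive letters along the standardisation gives a
tableau. -/
theorem Fills.mem_shST (hT : T₀ ∈ ShST l m n) (hab : (a : ℕ) + 1 = b) (h : Fills a b T₀ T A B)
    (h₀ : ∀ p, p ∈ boxes A ++ boxes B → HasLetter T₀ a p ∨ HasLetter T₀ b p)
    (hA : VShape A) (hB : VShape B) (hg : Good (boxes A ++ boxes B)) : T ∈ ShST l m n := by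
  have hne : a ≠ b := by rintro rfl; omega
  obtain ⟨hT, hc⟩ := hT
  obtain ⟨hlA, hlB, hlAB⟩ := List.pairwise_append.1 hg.lin
  have hin : ∀ p, p ∈ boxes A ++ boxes B →
      (∃ x, T p = some x ∧ (x.val = a ∨ x.val = b)) ∧
      (∃ x, T₀ p = some x ∧ (x.val = a ∨ x.val = b)) := by
    intro p hp
    constructor
    · rcases List.mem_append.1 hp with hp | hp
      · obtain ⟨g', hg⟩ := mem_boxes.1 hp
        exact ⟨_, h.left _ hg, .inl rfl⟩
      · obtain ⟨g', hg⟩ := mem_boxes.1 hp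
        exact ⟨_, h.right _ hg, .inr rfl⟩
    · rcases h₀ p hp with ⟨x, hx, hx'⟩ | ⟨x, hx, hx'⟩
      · exact ⟨x, hx, .inl hx'⟩
      · exact ⟨x, hx, .inr hx'⟩
  have hout : ∀ p, p ∉ boxes A ++ boxes B → T p = T₀ p ∧
      ∀ x, T₀ p = some x → x.val ≠ a ∧ x.val ≠ b := by
    intro p hp
    simp only [List.mem_append, not_or] at hp
    obtain ⟨h₁, h₂⟩ := h.off p hp.1 hp.2
    refine ⟨h₁, fun x hx => ⟨?_, ?_⟩⟩
    · rintro rfl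
      exact (h₂ x.primed).1 hx
    · rintro rfl
      exact (h₂ x.primed).2 hx
  have hmono : ∀ p q x y, p ≤ q → T p = some x → T q = some y → x ≤ y := by
    intro p q x y hpq hx hy
    by_cases hp : p ∈ boxes A ++ boxes B <;> by_cases hq : q ∈ boxes A ++ boxes B
    · by_cases hpq' : p = q
      · subst hpq'
        obtain rfl : x = y := by simpa [hx] using hy
        exact letter_le_refl x
      obtain ⟨⟨k, f⟩, hx', hx''⟩ := (hin p hp).1
      obtain ⟨⟨j, g⟩, hy', hy''⟩ := (hin q hq).1
      obtain rfl : x = ⟨k, f⟩ := by simpa [hx] using hx'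
      obtain rfl : y = ⟨j, g⟩ := by simpa [hy] using hy'
      have hkey : ∀ L : List ((ℕ × ℕ) × Bool), VShape L →
          (boxes L).Pairwise (fun p q => ¬ q ≤ p) → (p, f) ∈ L → (q, g) ∈ L →
          f = true ∨ g = false := by
        intro L hL hl h₁ h₂
        rcases hL.relTrans_of_le hl h₁ h₂ (by simp [hpq']) hpq with h | h
        · exact .inl h.1
        · exact .inr h.2.1
      simp only at hx'' hy''
      rcases hx'' with rfl | rfl <;> rcases hy'' with rfl | rfl
      · exact .inr ⟨rfl, hkey A hA hlA ((h.eq_left hne).1 hx) ((h.eq_left hne).1 hy)⟩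
      · exact .inl (by simp only [Fin.lt_def]; omega)
      · exact absurd hpq (hlAB q (mem_boxes.2 ⟨_, (h.eq_left hne).1 hy⟩) p
          (mem_boxes.2 ⟨_, (h.eq_right hne).1 hx⟩))
      · exact .inr ⟨rfl, hkey B hB hlB ((h.eq_right hne).1 hx) ((h.eq_right hne).1 hy)⟩
    · obtain ⟨⟨x', hx', hx''⟩, x₀, hx₀, hx₀'⟩ := hin p hp
      obtain rfl : x = x' := by simpa [hx] using hx'
      obtain ⟨hy', hy''⟩ := hout q hq
      rw [hy'] at hy
      have := hT.mono hx₀ hy hpq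
      have := hy'' y hy
      rw [letter_le_iff] at *
      omega
    · obtain ⟨⟨y', hy', hy''⟩, y₀, hy₀, hy₀'⟩ := hin q hq
      obtain rfl : y = y' := by simpa [hy] using hy'
      obtain ⟨hx', hx''⟩ := hout p hp
      rw [hx'] at hx
      have := hT.mono hx hy₀ hpq
      have := hx'' x hx
      rw [letter_le_iff] at *
      omega
    · rw [(hout p hp).1] at hx
      rw [(hout q hq).1] at hy
      exact hT.mono hx hy hpq
  have hkeep : ∀ k, k ≠ a → k ≠ b → ∀ p g, T p = some ⟨k, g⟩ ↔ T₀ p = some ⟨k, g⟩ :=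
    fun k ha hb p g => h.eq_of_ne h₀ ha hb
  have hcases : ∀ (Q : Fin n → Prop), Q a → Q b → (∀ k, k ≠ a → k ≠ b → Q k) → ∀ k, Q k := by
    intro Q ha hb hk k
    by_cases h₁ : k = a
    · exact h₁ ▸ ha
    · by_cases h₂ : k = b
      · exact h₂ ▸ hb
      · exact hk k h₁ h₂
  refine ⟨⟨fun p => ?_, fun r c d x y hcd hx hy => hmono (r, c) (r, d) x y ⟨le_rfl, hcd.le⟩ hx hy,
    fun r s c x y hrs hx hy => hmono (r, c) (s, c) x y ⟨hrs.le, le_rfl⟩ hx hy, fun r s c => ?_,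
    fun r c d => ?_⟩, ?_⟩
  · by_cases hp : p ∈ boxes A ++ boxes B
    · obtain ⟨⟨x, hx, -⟩, y, hy, -⟩ := hin p hp
      rw [← hT.shape p, hx, hy]
      simp
    · rw [(hout p hp).1, hT.shape p]
  · refine hcases _ (fun h₁ h₂ => ?_) (fun h₁ h₂ => ?_) (fun k ha hb h₁ h₂ => ?_)
    · by_contra hrs
      rcases hA.rt_or_rt ((h.eq_left hne).1 h₁) ((h.eq_left hne).1 h₂) rfl rfl (by simp [hrs])
        with h | h <;> exact lt_irrefl _ h.1
    · by_contra hrs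
      rcases hB.rt_or_rt ((h.eq_right hne).1 h₁) ((h.eq_right hne).1 h₂) rfl rfl (by simp [hrs])
        with h | h <;> exact lt_irrefl _ h.1
    · exact hT.col_unprimed r s c k ((hkeep k ha hb _ _).1 h₁) ((hkeep k ha hb _ _).1 h₂)
  · have hkey : ∀ L : List ((ℕ × ℕ) × Bool), VShape L → ((r, c), true) ∈ L →
        ((r, d), true) ∈ L → c = d := by
      intro L hL h₁ h₂
      by_contra hcd
      rcases hL.relTrans_or h₁ h₂ (by simp [hcd]) with h | h <;> simp [RelTrans, Down] at h
    refine hcases _ (fun h₁ h₂ => ?_) (fun h₁ h₂ => ?_) (fun k ha hb h₁ h₂ => ?_)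
    · exact hkey A hA ((h.eq_left hne).1 h₁) ((h.eq_left hne).1 h₂)
    · exact hkey B hB ((h.eq_right hne).1 h₁) ((h.eq_right hne).1 h₂)
    · exact hT.row_primed r c d k ((hkeep k ha hb _ _).1 h₁) ((hkeep k ha hb _ _).1 h₂)
  · have hkey : ∀ (k : Fin n) (L : List ((ℕ × ℕ) × Bool)), VShape L →
        (∀ p g, T p = some ⟨k, g⟩ ↔ (p, g) ∈ L) → ∀ p g, T p = some ⟨k, g⟩ → IsFirst T k p →
          g = false := by
      intro k L hL hm p g hp hf
      by_contra hgt
      obtain rfl : g = true := by simpa using hgt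
      obtain ⟨L₁, L₂, rfl⟩ := List.append_of_mem ((hm _ _).1 hp)
      have hv := (vshape_append.1 hL).2
      cases L₂ with
      | nil => exact absurd hv (by simp [VShape])
      | cons w L₂ =>
        -- A primed entry is followed by a box in a lower row, which is read earlier.
        rcases hv.1 with h | h
        · exact hf.2 w.1 ⟨⟨k, w.2⟩, (hm _ _).2 (by simp), rfl⟩ (.inl h.2.1)
        · simp at h
    funext p
    rcases hp : T p with _ | ⟨k, g⟩
    · simp [canonicalize, hp]
    · have : IsFirst T k p → g = false := by
        revert hp
        refine hcases (fun k => T p = some ⟨k, g⟩ → IsFirst T k p → g = false)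
          (hkey a A hA (fun _ _ => h.eq_left hne) p g)
          (hkey b B hB (fun _ _ => h.eq_right hne) p g) (fun k ha hb hp hf => ?_) k
        refine canonical_flag hc ((hkeep k ha hb _ _).1 hp) ?_
        have hl : ∀ q, HasLetter T₀ k q ↔ HasLetter T k q := fun q => by
          simp only [hasLetter_iff, hkeep k ha hb]
        exact ⟨(hl p).2 hf.1, fun q hq => hf.2 q ((hl q).1 hq)⟩
      rw [canonicalize, hp, Option.map_some]
      split_ifs with hf
      · rw [this hf]
      · rfl

end

/-! ### Shifted Bender–Knuth moves -/

section
variable {n : ℕ} {l m : StrictPartition} {a b : Fin n} {T : Filling n}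
  {A B : List ((ℕ × ℕ) × Bool)}

theorem Row.coe_eq {x x' : ℕ × ℕ} {ys ys' : List (ℕ × ℕ)} (h : Row x ys ys' x') :
    x ::ₘ (ys : Multiset (ℕ × ℕ)) = x' ::ₘ (ys' : Multiset (ℕ × ℕ)) := by
  induction h with
  | nil => rfl
  | @cons x y y' x' ys ys' x'' hs _ ih =>
    rw [← Multiset.cons_coe, ← Multiset.cons_coe, Multiset.cons_swap x'' y', ← ih]
    cases hs with
    | move => rfl
    | pass => exact Multiset.cons_swap _ _ _

theorem Grid.perm {xs ys ys' xs' : List (ℕ × ℕ)} (h : Grid xs ys ys' xs') :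
    (ys' ++ xs').Perm (xs ++ ys) := by
  rw [← Multiset.coe_eq_coe]
  induction h with
  | nil => simp
  | cons _ hr ih =>
    have := hr.coe_eq
    simp only [← Multiset.coe_add, ← Multiset.cons_coe, Multiset.add_cons, Multiset.cons_add]
      at ih this ⊢
    rw [← ih, ← Multiset.cons_add, ← this, Multiset.cons_add]

/-- The switching process applies the growth diagram to the standardisations. -/
theorem Standardises.exists_sp (h : Standardises a b T A B) (hab : a ≠ b) :
    ∃ A' B', Grid (boxes A) (boxes B) (boxes B') (boxes A') ∧ VShape A' ∧ VShape B' ∧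
      Fills a b T (SP a b T) A' B' ∧ Good (boxes B' ++ boxes A') := by
  obtain ⟨hA, hB, hg, hF⟩ := h
  rcases List.eq_nil_or_concat A with rfl | ⟨xs, ⟨x, f⟩, rfl⟩
  · have hg' : Good (boxes B ++ boxes []) := by simpa using hg
    rw [(Run.done (hF.fullySwitched hab hg')).sp_eq]
    exact ⟨[], B, .nil _, trivial, hB, hF, hg'⟩
  · rw [List.concat_eq_append] at *
    obtain ⟨hpre, hf⟩ := vshape_append.1 hA
    obtain rfl : f = false := hf
    -- The last box of `A` moves first. It is unprimed, as `SuffixInv` demands while nothing has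
    -- been moved.
    have hI : Inv xs [] x false B [] := by
      refine ⟨by simpa using hB, ⟨x, [], .nil _, by simpa using hg, hpre, ?_, fun u hu r hr hit =>
        by simpa using hit.mem⟩, rfl⟩
      simpa using hB.noTwoDiagonal fun z hz => hg.box z (List.mem_append_right _ hz)
    obtain ⟨R₁, x₁, Xp, T', A', B', hrun, hrow, hgrid, hA', h₁, h₂, h₃, h₄⟩ :=
      hI.run hab _ _ rfl rfl (T := T) (T₀ := T) (by simpa using hF)
    rw [hrun.sp_eq]
    refine ⟨A', B', ?_, h₁, h₂, h₃, h₄⟩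
    rw [hA']
    simpa using Grid.snoc hrow (by simpa using hgrid)

theorem Standardises.hasLetter_of_mem (h : Standardises a b T A B) (hab : a ≠ b) {p : ℕ × ℕ}
    (hp : p ∈ boxes A ++ boxes B) : HasLetter T a p ∨ HasLetter T b p := by
  rwa [h.fills.hasLetter_left hab, h.fills.hasLetter_right hab, ← List.mem_append]

end

/-! ### The operators `t_i` on standardisations: involutivity, weight, commutation. -/

section
variable {n : ℕ} {l m : StrictPartition} {i : Fin n} {T : Filling (n + 1)}
  {A B : List ((ℕ × ℕ) × Bool)}

theorem castSucc_add_one (i : Fin n) : ((i.castSucc : Fin (n + 1)) : ℕ) + 1 = i.succ := by simp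

theorem castSucc_ne_succ (i : Fin n) : i.castSucc ≠ i.succ := by
  simp [Fin.ext_iff]

/-- The effect of a Bender–Knuth move on standardisations. -/
theorem Standardises.benderKnuth (h : Standardises i.castSucc i.succ T A B)
    (hT : T ∈ ShST l m (n + 1)) :
    ∃ A' B', Grid (boxes A) (boxes B) (boxes A') (boxes B') ∧
      Standardises i.castSucc i.succ (benderKnuth i T) A' B' ∧
      Fills i.castSucc i.succ T (ShiftedBK.benderKnuth i T) A' B' ∧
      ShiftedBK.benderKnuth i T ∈ ShST l m (n + 1) := by
  have hab := castSucc_ne_succ i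
  obtain ⟨B', A', hgrid, hB', hA', hF, hg⟩ := h.exists_sp hab
  have hF' : Fills i.castSucc i.succ T (fun p => (SP i.castSucc i.succ T p).map fun x =>
      ⟨theta i x.val, x.primed⟩) A' B' := by
    refine ⟨fun z hz => ?_, fun z hz => ?_, fun p h₁ h₂ => ?_⟩
    · simp [hF.right z hz, theta]
    · simp [hF.left z hz, theta]
    · obtain ⟨h₃, h₄⟩ := hF.off p h₂ h₁
      refine ⟨?_, h₄⟩
      rw [h₃]
      rcases hp : T p with _ | x
      · rfl
      · have ha : x.val ≠ i.castSucc := fun e => (h₄ x.primed).1 (by rw [hp, ← e])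
        have hb : x.val ≠ i.succ := fun e => (h₄ x.primed).2 (by rw [hp, ← e])
        simp only [Option.map_some, theta, Equiv.swap_apply_of_ne_of_ne ha hb]
  have h₀ : ∀ p, p ∈ boxes A' ++ boxes B' →
      HasLetter T i.castSucc p ∨ HasLetter T i.succ p := fun p hp =>
    h.hasLetter_of_mem hab (hgrid.perm.mem_iff.1 hp)
  have hS := hF'.mem_shST hT (castSucc_add_one i) h₀ hA' hB' hg
  -- The relabelled filling is already canonical, so the canonical form taken in `permFilling`
  -- changes nothing.
  have hbk : ShiftedBK.benderKnuth i T = fun p => (SP i.castSucc i.succ T p).map fun x =>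
      ⟨theta i x.val, x.primed⟩ := hS.2
  rw [hbk]
  refine ⟨A', B', hgrid, ⟨hA', hB', hg, hF'.left, hF'.right, fun p h₁ h₂ => ⟨rfl, ?_⟩⟩, hF', hS⟩
  rw [(hF'.off p h₁ h₂).1]
  exact (hF'.off p h₁ h₂).2

theorem benderKnuth_mem (hT : T ∈ ShST l m (n + 1)) : benderKnuth i T ∈ ShST l m (n + 1) := by
  obtain ⟨A, B, h⟩ := exists_standardises hT (castSucc_add_one i)
  obtain ⟨_, _, -, -, -, h'⟩ := h.benderKnuth hT
  exact h'

theorem benderKnuth_involutive (hT : T ∈ ShST l m (n + 1)) :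
    benderKnuth i (benderKnuth i T) = T := by
  obtain ⟨A, B, h⟩ := exists_standardises hT (castSucc_add_one i)
  obtain ⟨A₁, B₁, hg₁, h₁, hF₁, hT₁⟩ := h.benderKnuth hT
  obtain ⟨A₂, B₂, hg₂, h₂, hF₂, -⟩ := h₁.benderKnuth hT₁
  -- The second diagram is the reflection of the first; equal boxes then give equal primes.
  obtain ⟨eA, eB⟩ := hg₁.symm.unique hg₂
  obtain rfl := h.left.eq_of_boxes_eq h₂.left eA
  obtain rfl := h.right.eq_of_boxes_eq h₂.right eB
  funext p
  by_cases hA : p ∈ boxes A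
  · obtain ⟨g, hg⟩ := mem_boxes.1 hA
    rw [hF₂.left _ hg, h.fills.left _ hg]
  · by_cases hB : p ∈ boxes B
    · obtain ⟨g, hg⟩ := mem_boxes.1 hB
      rw [hF₂.right _ hg, h.fills.right _ hg]
    · have := not_congr (hg₁.perm.mem_iff (a := p))
      simp only [List.mem_append, not_or] at this
      obtain ⟨hA₁, hB₁⟩ := this.2 ⟨hA, hB⟩
      rw [(hF₂.off p hA hB).1, (hF₁.off p hA₁ hB₁).1]

theorem Fills.weight_left {a b : Fin n} {T₀ T : Filling n} (h : Fills a b T₀ T A B)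
    (hab : a ≠ b) (hA : (boxes A).Nodup) : weight T a = A.length := by
  classical
  have : {p | HasLetter T a p} = ((boxes A).toFinset : Set (ℕ × ℕ)) := by
    ext p
    simp only [Set.mem_ofPred_eq, h.hasLetter_left hab, List.coe_toFinset]
  rw [weight, this, Set.ncard_coe_finset, List.toFinset_card_of_nodup hA, List.length_map]

theorem Standardises.weight {a b : Fin n} {T : Filling n} (h : Standardises a b T A B)
    (hab : a ≠ b) : weight T a = A.length ∧ weight T b = B.length := by
  obtain ⟨h₁, h₂, -⟩ := List.nodup_append.1 h.good.nodup
  exact ⟨h.fills.weight_left hab h₁, h.fills.symm.weight_left hab.symm h₂⟩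

theorem Standardises.benderKnuth_eq_iff (h : Standardises i.castSucc i.succ T A B)
    (hT : T ∈ ShST l m (n + 1)) {k : Fin (n + 1)} (ha : k ≠ i.castSucc) (hb : k ≠ i.succ)
    {p : ℕ × ℕ} {g : Bool} :
    ShiftedBK.benderKnuth i T p = some ⟨k, g⟩ ↔ T p = some ⟨k, g⟩ := by
  obtain ⟨A₁, B₁, hg, -, hF, -⟩ := h.benderKnuth hT
  exact hF.eq_of_ne (fun p hp => h.hasLetter_of_mem (castSucc_ne_succ i)
    (hg.perm.mem_iff.1 hp)) ha hb

theorem weight_benderKnuth (hT : T ∈ ShST l m (n + 1)) :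
    weight (benderKnuth i T) = permVector (theta i) (weight T) := by
  obtain ⟨A, B, h⟩ := exists_standardises hT (castSucc_add_one i)
  obtain ⟨A₁, B₁, hg, h₁, -, -⟩ := h.benderKnuth hT
  have hab := castSucc_ne_succ i
  have hl := hg.length_eq
  simp only [List.length_map] at hl
  funext k
  rw [permVector, theta, Equiv.swap_inv]
  by_cases ha : k = i.castSucc
  · rw [ha, Equiv.swap_apply_left, (h₁.weight hab).1, (h.weight hab).2, hl.1]
  · by_cases hb : k = i.succ
    · rw [hb, Equiv.swap_apply_right, (h₁.weight hab).2, (h.weight hab).1, hl.2]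
    · rw [Equiv.swap_apply_of_ne_of_ne ha hb]
      simp only [weight, hasLetter_iff, h.benderKnuth_eq_iff hT ha hb]

/-- A Bender–Knuth move does not change the standardisation of other letters. -/
theorem Standardises.of_benderKnuth {c d : Fin (n + 1)} {C D : List ((ℕ × ℕ) × Bool)}
    (hT : T ∈ ShST l m (n + 1)) (h : Standardises c d T C D) (hcd : c ≠ d)
    (hc₁ : c ≠ i.castSucc) (hc₂ : c ≠ i.succ) (hd₁ : d ≠ i.castSucc) (hd₂ : d ≠ i.succ) :
    Standardises c d (ShiftedBK.benderKnuth i T) C D := by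
  obtain ⟨A, B, h'⟩ := exists_standardises hT (castSucc_add_one i)
  refine ⟨h.left, h.right, h.good, (fills_self_iff hcd).2 ?_⟩
  have := (fills_self_iff hcd).1 h.fills
  simpa only [h'.benderKnuth_eq_iff hT hc₁ hc₂, h'.benderKnuth_eq_iff hT hd₁ hd₂] using this

/-- Each move keeps the standardisation used by the other, so both orders run the same two diagrams
on disjoint sets of boxes. -/
theorem benderKnuth_comm {j : Fin n} (hij : 1 < |((i : ℕ) : ℤ) - ((j : ℕ) : ℤ)|)
    (hT : T ∈ ShST l m (n + 1)) :
    benderKnuth i (benderKnuth j T) = benderKnuth j (benderKnuth i T) := by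
  have hij' : (i : ℕ) + 1 < j ∨ (j : ℕ) + 1 < i := by
    rcases lt_abs.1 hij with h | h <;> omega
  have e₁ : i.castSucc ≠ j.castSucc := by simp [Fin.ext_iff]; omega
  have e₂ : i.castSucc ≠ j.succ := by simp [Fin.ext_iff]; omega
  have e₃ : i.succ ≠ j.castSucc := by simp [Fin.ext_iff]; omega
  have e₄ : i.succ ≠ j.succ := by simp [Fin.ext_iff]; omega
  have hi := castSucc_ne_succ i
  have hj := castSucc_ne_succ j
  obtain ⟨A, B, h⟩ := exists_standardises hT (castSucc_add_one i)
  obtain ⟨C, D, k⟩ := exists_standardises hT (castSucc_add_one j)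
  have h' : Standardises i.castSucc i.succ (benderKnuth j T) A B :=
    Standardises.of_benderKnuth hT h hi e₁ e₂ e₃ e₄
  have k' : Standardises j.castSucc j.succ (benderKnuth i T) C D :=
    Standardises.of_benderKnuth hT k hj e₁.symm e₃.symm e₂.symm e₄.symm
  obtain ⟨A₁, B₁, hg, h₁, hF, -⟩ := h.benderKnuth hT
  obtain ⟨C₁, D₁, kg, k₁, kF, -⟩ := k.benderKnuth hT
  obtain ⟨A₂, B₂, hg', h₂, hF', -⟩ := h'.benderKnuth (benderKnuth_mem hT)
  obtain ⟨C₂, D₂, kg', k₂, kF', -⟩ := k'.benderKnuth (benderKnuth_mem hT)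
  obtain ⟨eA, eB⟩ := hg.unique hg'
  obtain ⟨eC, eD⟩ := kg.unique kg'
  obtain rfl := h₁.left.eq_of_boxes_eq h₂.left eA
  obtain rfl := h₁.right.eq_of_boxes_eq h₂.right eB
  obtain rfl := k₁.left.eq_of_boxes_eq k₂.left eC
  obtain rfl := k₁.right.eq_of_boxes_eq k₂.right eD
  funext p
  have hm := hg.perm.mem_iff (a := p)
  have km := kg.perm.mem_iff (a := p)
  by_cases hp : p ∈ boxes A₁ ++ boxes B₁
  · have hq : p ∉ boxes C₁ ++ boxes D₁ := by
      intro hq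
      rcases h.hasLetter_of_mem hi (hm.1 hp) with ⟨x, hx, hx'⟩ | ⟨x, hx, hx'⟩ <;>
        rcases k.hasLetter_of_mem hj (km.1 hq) with ⟨y, hy, hy'⟩ | ⟨y, hy, hy'⟩ <;>
        obtain rfl : x = y := by simpa [hx] using hy
      · exact e₁ (hx'.symm.trans hy')
      · exact e₂ (hx'.symm.trans hy')
      · exact e₃ (hx'.symm.trans hy')
      · exact e₄ (hx'.symm.trans hy')
    simp only [List.mem_append, not_or] at hq
    rw [(kF'.off p hq.1 hq.2).1]
    rcases List.mem_append.1 hp with hp | hp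
    · obtain ⟨g, hp⟩ := mem_boxes.1 hp
      rw [hF'.left _ hp, hF.left _ hp]
    · obtain ⟨g, hp⟩ := mem_boxes.1 hp
      rw [hF'.right _ hp, hF.right _ hp]
  · simp only [List.mem_append, not_or] at hp
    rw [(hF'.off p hp.1 hp.2).1]
    by_cases hC : p ∈ boxes C₁
    · obtain ⟨g, hC⟩ := mem_boxes.1 hC
      rw [kF'.left _ hC, kF.left _ hC]
    · by_cases hD : p ∈ boxes D₁
      · obtain ⟨g, hD⟩ := mem_boxes.1 hD
        rw [kF'.right _ hD, kF.right _ hD]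
      · rw [(kF'.off p hC hD).1, (kF.off p hC hD).1, (hF.off p hp.1 hp.2).1]

theorem permVector_theta (ν : Fin (n + 1) → ℕ) :
    permVector (theta i) (permVector (theta i) ν) = ν := by
  funext k
  simp only [permVector, theta, Equiv.swap_inv, Equiv.swap_apply_self]

end

end ShiftedBK

theorem mainTheorem5 (n : ℕ) (l m : ShiftedBK.StrictPartition) (hml : m ≤ l) (i : Fin n) :
    -- `t_i` is an operator on `ShST(l / m, n + 1)`
    (∀ T ∈ ShiftedBK.ShST l m (n + 1),
      ShiftedBK.benderKnuth i T ∈ ShiftedBK.ShST l m (n + 1)) ∧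
    -- `t_i ^ 2 = 1`
    (∀ T ∈ ShiftedBK.ShST l m (n + 1),
      ShiftedBK.benderKnuth i (ShiftedBK.benderKnuth i T) = T) ∧
    -- `t_i t_j = t_j t_i` for `|i - j| > 1`
    (∀ j : Fin n, 1 < |((i : ℕ) : ℤ) - ((j : ℕ) : ℤ)| →
      ∀ T ∈ ShiftedBK.ShST l m (n + 1),
        ShiftedBK.benderKnuth i (ShiftedBK.benderKnuth j T) =
          ShiftedBK.benderKnuth j (ShiftedBK.benderKnuth i T)) ∧
    -- `wt(t_i(T)) = θ_i(wt(T))`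
    (∀ T ∈ ShiftedBK.ShST l m (n + 1),
      ShiftedBK.weight (ShiftedBK.benderKnuth i T) =
        ShiftedBK.permVector (ShiftedBK.theta i) (ShiftedBK.weight T)) ∧
    -- `t_i` is a bijection from the tableaux of weight `ν` to those of weight `θ_i(ν)`
    (∀ ν : Fin (n + 1) → ℕ,
      Set.BijOn (ShiftedBK.benderKnuth i)
        {T | T ∈ ShiftedBK.ShST l m (n + 1) ∧ ShiftedBK.weight T = ν}
        {T | T ∈ ShiftedBK.ShST l m (n + 1) ∧
          ShiftedBK.weight T = ShiftedBK.permVector (ShiftedBK.theta i) ν}) := by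
  open ShiftedBK in
  refine ⟨fun T hT => benderKnuth_mem hT, fun T hT => benderKnuth_involutive hT,
    fun j hij T hT => benderKnuth_comm hij hT, fun T hT => weight_benderKnuth hT, fun ν =>
      ⟨fun T hT => ⟨benderKnuth_mem hT.1, ?_⟩, fun T hT S hS h => ?_, fun T hT =>
        ⟨benderKnuth i T, ⟨benderKnuth_mem hT.1, ?_⟩, benderKnuth_involutive hT.1⟩⟩⟩
  · rw [weight_benderKnuth hT.1, hT.2]
  · rw [← benderKnuth_involutive (i := i) hT.1, h, benderKnuth_involutive hS.1]
  · rw [weight_benderKnuth hT.1, hT.2, permVector_theta]
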